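/- Let $A$ be a Hopf $*$-algebra over $\mathbb{C}$ and let $B \subseteq A$ be a $*$-subalgebra which is a quantum homogeneous $A$-space, that is, $\Delta(B) \subseteq A \otimes B$, $A$ is faithfully flat as a right $B$-module, and $B^+A = AB^+$ for $B^+ := B \cap \ker(\varepsilon)$. Let $(\Omega^\bullet, \mathrm{d})$ be a differential $*$-calculus over $B$ (so $\Omega^0 = B$ and $\Omega^\bullet$ is generated as an algebra by the elements $b, \mathrm{d}b$, for $b \in B$) which is covariant: the coaction $\Delta : B \to A \otimes B$ extends to a left $A$-comodule algebra structure $\omega \mapsto \omega_{(-1)} \otimes \omega_{(0)}$ on $\Omega^\bullet$ for which $\mathrm{d}$ is a comodule map. Assume that $\Omega^\bullet \in {}^A_B\mathrm{mod}_0$, that is, $\Omega^\bullet$ is finitely generated as a left $B$-module, and $\omega b = \omega_{(-2)} b S(\omega_{(-1)}) \omega_{(0)}$ for all $\omega \in \Omega^\bullet$, $b \in B$. Let $(\Omega^{(\bullet,\bullet)}, \sigma)$ be a covariant Hermitian structure for $\Omega^\bullet$, of total degree $2n$: a complex structure $\Omega^{(\bullet,\bullet)}$ all of whose components $\Omega^{(a,b)}$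 are left $A$-subcomodules, and a central, real, left $A$-coinvariant form $\sigma \in \Omega^{(1,1)}$ such that, for $L_\sigma(\omega) := \sigma \wedge \omega$, the maps $L_\sigma^{n-k} : \Omega^k \to \Omega^{2n-k}$, $k = 0, \dots, n-1$, are isomorphisms. Let $\ast_\sigma$ be its Hodge map, the unique linear map with $$\ast_\sigma(L_\sigma^j(\alpha)) = (-1)^{\frac{k(k+1)}{2}}\, \mathbf{i}^{a-b}\, \frac{j!}{(n-j-k)!}\, L_\sigma^{n-j-k}(\alpha)$$ for all $\alpha \in \Omega^{(a,b)}$ with $a + b = k \leq n$ and $L_\sigma^{n-k+1}(\alpha) = 0$, and all $0 \leq j \leq n-k$. Let $g_\sigma : \Omega^\bullet \times \Omega^\bullet \to B$ be the associated metric: the biadditive map with $g_\sigma(\Omega^k, \Omega^l) = 0$ for $k \neq l$, and $g_\sigma(\omega, \nu) = \ast_\sigma(\omega \wedge \ast_\sigma(\nu^*))$ for $\omega, \nu \in \Omega^k$. Let $B_{>0}$ be the set of non-zero finite sums of elements $b^*b$, $b \in B$, and assume that the Hermitian structure is positive definite: $g_\sigma(\omega, \omega) \in B_{>0}$ for all non-zero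 $\omega \in \Omega^\bullet$. Then $(\Omega^\bullet, h_\sigma)$ is an Hermitian module, where $$h_\sigma : \overline{\Omega^\bullet} \to {}^\vee(\Omega^\bullet) = {}_B\mathrm{Hom}(\Omega^\bullet, B), \qquad \overline{\omega} \mapsto g_\sigma(-, \omega),$$ so that $h_\sigma(\overline{\omega})(\nu) = \ast_\sigma(\nu \wedge \ast_\sigma(\omega^*))$ for $\omega, \nu$ of the same degree. That is: $\Omega^\bullet$ is a finitely generated projective left $B$-module; $h_\sigma$ is a well-defined isomorphism of right $B$-modules, where $\overline{\omega}\, b := \overline{b^*\omega}$ and $(\varphi b)(\nu) := \varphi(\nu) b$; and the pairing $h_\sigma(\omega, \nu) := h_\sigma(\overline{\nu})(\omega)$ satisfies $h_\sigma(\omega, \nu) = h_\sigma(\nu, \omega)^*$ for all $\omega, \nu$, and $h_\sigma(\omega, \omega) \in B_{>0}$ for all $\omega \neq 0$. -/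

import Mathlib

open scoped TensorProduct

universe u

namespace NCGeom

noncomputable section

/-! ## Hopf `*`-algebras and quantum homogeneous spaces -/

section QuantumHomogeneous

variable {A : Type u} [Ring A] [HopfAlgebra ℂ A] [StarRing A] [StarModule ℂ A]

variable (A) in
/-- A Hopf algebra over `ℂ` with a conjugate-linear involutive anti-automorphism `*` is a
Hopf `*`-algebra if the coproduct is a `*`-homomorphism (where `(a ⊗ b)* = a* ⊗ b*`). -/
def IsHopfStarAlgebra : Prop :=
  ∀ a : A, Coalgebra.comul (R := ℂ) (star a) = star (Coalgebra.comul (R := ℂ) a)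

variable (B : StarSubalgebra ℂ A)

/-- The inclusion `B → A` as a `ℂ`-linear map. -/
def incl : B →ₗ[ℂ] A := B.subtype.toAlgHom.toLinearMap

/-- The relations `ab ⊗ m = a ⊗ bm` defining `A ⊗_B M` as a quotient of `A ⊗_ℂ M`. -/
def balancedRel (M : Type u) [AddCommGroup M] [Module ℂ M] [Module B M] :
    Submodule ℂ (A ⊗[ℂ] M) :=
  Submodule.span ℂ
    {x | ∃ (a : A) (b : B) (m : M), x = (a * (b : A)) ⊗ₜ[ℂ] m - a ⊗ₜ[ℂ] (b • m)}

/-- The complex vector space `A ⊗_B M`, for a left `B`-module `M`. -/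
abbrev BalancedTensor (M : Type u) [AddCommGroup M] [Module ℂ M] [Module B M] : Type u :=
  (A ⊗[ℂ] M) ⧸ balancedRel B M

/-- The map `id ⊗_B f : A ⊗_B M → A ⊗_B N` induced by a left `B`-module map `f : M → N`. -/
def balancedMap {M N : Type u} [AddCommGroup M] [Module ℂ M] [Module B M] [IsScalarTower ℂ B M]
    [AddCommGroup N] [Module ℂ N] [Module B N] [IsScalarTower ℂ B N] (f : M →ₗ[B] N) :
    BalancedTensor B M →ₗ[ℂ] BalancedTensor B N :=
  Submodule.mapQ _ _ (LinearMap.lTensor A (f.restrictScalars ℂ)) <| by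
    refine Submodule.span_le.2 ?_
    rintro x ⟨a, b, m, rfl⟩
    refine Submodule.subset_span ⟨a, b, f m, ?_⟩
    simp

/-- `A` is faithfully flat as a right `B`-module: the functor `A ⊗_B -` preserves and reflects
exact sequences of left `B`-modules. -/
def IsFaithfullyFlatRight : Prop :=
  ∀ (M N P : Type u)
    [AddCommGroup M] [Module ℂ M] [Module B M] [IsScalarTower ℂ B M]
    [AddCommGroup N] [Module ℂ N] [Module B N] [IsScalarTower ℂ B N]
    [AddCommGroup P] [Module ℂ P] [Module B P] [IsScalarTower ℂ B P]
    (f : M →ₗ[B] N) (g : N →ₗ[B] P),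
    Function.Exact f g ↔ Function.Exact (balancedMap B f) (balancedMap B g)

/-- `B` is a left coideal of `A`: `Δ(B) ⊆ A ⊗ B`. -/
def IsLeftCoideal : Prop :=
  ∀ b : B, Coalgebra.comul (R := ℂ) (b : A) ∈ LinearMap.range (LinearMap.lTensor A (incl B))

/-- `B⁺ = B ∩ ker ε`, as a subspace of `A`. -/
def augmentation : Submodule ℂ A :=
  B.toSubalgebra.toSubmodule ⊓ LinearMap.ker (Coalgebra.counit (R := ℂ) (A := A))

/-- The `*`-subalgebra `B ⊆ A` is a quantum homogeneous `A`-space: a left coideal subalgebra such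
that `A` is faithfully flat as a right `B`-module and `B⁺A = AB⁺` (products of subspaces, that is,
spans of products of elements). -/
structure IsQuantumHomogeneous : Prop where
  leftCoideal : IsLeftCoideal B
  faithfullyFlat : IsFaithfullyFlatRight B
  augmentation_mul : augmentation B * ⊤ = ⊤ * augmentation B

/-! ## Relative Hopf modules -/

/-- `δ : F → A ⊗ F` is a left `A`-comodule structure (coassociative and counital). -/
structure IsLeftCoaction {F : Type u} [AddCommGroup F] [Module ℂ F]
    (δ : F →ₗ[ℂ] A ⊗[ℂ] F) : Prop where
  coassoc : ∀ f : F,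
    TensorProduct.assoc ℂ A A F (LinearMap.rTensor F (Coalgebra.comul (R := ℂ)) (δ f)) =
      LinearMap.lTensor A δ (δ f)
  counit : ∀ f : F,
    TensorProduct.lid ℂ F (LinearMap.rTensor F (Coalgebra.counit (R := ℂ)) (δ f)) = f

/-- The map `a ↦ a₍₁₎ b S(a₍₂₎)` on `A`. -/
def adjointMap (b : A) : A →ₗ[ℂ] A :=
  LinearMap.mul' ℂ A ∘ₗ
    TensorProduct.map (LinearMap.mulRight ℂ b) (HopfAlgebra.antipode ℂ (A := A)) ∘ₗ
      Coalgebra.comul (R := ℂ)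

/-- The left action `B ⊗ F → F`. -/
def leftAction (F : Type u) [AddCommGroup F] [Module ℂ F] [Module B F] [IsScalarTower ℂ B F] :
    B ⊗[ℂ] F →ₗ[ℂ] F :=
  TensorProduct.lift (Algebra.lsmul ℂ ℂ F : B →ₐ[ℂ] Module.End ℂ F).toLinearMap

/-- The action `(A ⊗ B) × (A ⊗ F) → A ⊗ F`, `(a ⊗ b)(a' ⊗ f) = aa' ⊗ bf`. -/
def tensorAction (F : Type u) [AddCommGroup F] [Module ℂ F] [Module B F] [IsScalarTower ℂ B F] :
    A ⊗[ℂ] B →ₗ[ℂ] A ⊗[ℂ] F →ₗ[ℂ] A ⊗[ℂ] F :=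
  TensorProduct.map₂ (LinearMap.mul ℂ A)
    (Algebra.lsmul ℂ ℂ F : B →ₐ[ℂ] Module.End ℂ F).toLinearMap

/-- The object `(F, δ)` belongs to the category `{}^A_B mod₀`: it is a left `A`-comodule and a
finitely generated left `B`-module with `δ(bf) = Δ(b)δ(f)`, and its right `B`-action is
`fb = f₍₋₂₎ b S(f₍₋₁₎) f₍₀₎`. Here `Δ(b)` is regarded as an element of `A ⊗ B`, and
`f₍₋₂₎ b S(f₍₋₁₎) ⊗ f₍₀₎` as an element of `B ⊗ F`, through the inclusion `B → A`. -/
structure IsRelativeHopfModule₀ (F : Type u) [AddCommGroup F] [Module ℂ F] [Module B F]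
    [IsScalarTower ℂ B F] [Module Bᵐᵒᵖ F] (δ : F →ₗ[ℂ] A ⊗[ℂ] F) : Prop where
  coaction : IsLeftCoaction δ
  finite : Module.Finite B F
  coaction_smul : ∀ (b : B) (f : F), ∃ t : A ⊗[ℂ] B,
    LinearMap.lTensor A (incl B) t = Coalgebra.comul (R := ℂ) (b : A) ∧
      δ (b • f) = tensorAction B F t (δ f)
  right_smul : ∀ (b : B) (f : F), ∃ t : B ⊗[ℂ] F,
    LinearMap.rTensor F (incl B) t = LinearMap.rTensor F (adjointMap (b : A)) (δ f) ∧
      MulOpposite.op b • f = leftAction B F t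

end QuantumHomogeneous

/-! ## Hermitian modules over a `*`-algebra -/

section HermitianModule

/-- The conjugate `F̄` of a left `B`-module `F`: the same abelian group, with elements written
`ConjModule.mk f` for `f̄`, and right `B`-action `f̄ b = \overline{b* f}`. -/
def ConjModule (F : Type u) : Type u := F

namespace ConjModule

/-- The element `f̄` of the conjugate module. -/
def mk {F : Type u} (f : F) : ConjModule F := f

instance (F : Type u) [AddCommGroup F] : AddCommGroup (ConjModule F) :=
  inferInstanceAs (AddCommGroup F)

instance (B F : Type u) [Ring B] [StarRing B] [AddCommGroup F] [Module B F] :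
    Module Bᵐᵒᵖ (ConjModule F) where
  smul b f := (mk (star b.unop • (show F from f)) : ConjModule F)
  one_smul f := show star (1 : B) • (show F from f) = f by rw [star_one, one_smul]
  mul_smul b c f := show star (c.unop * b.unop) • (show F from f) =
    star b.unop • star c.unop • (show F from f) by rw [star_mul, mul_smul]
  smul_zero b := show star b.unop • (0 : F) = 0 from smul_zero _
  smul_add b f g := show star b.unop • ((show F from f) + (show F from g)) =
    star b.unop • (show F from f) + star b.unop • (show F from g) from smul_add _ _ _
  add_smul b c f := show star (b.unop + c.unop) • (show F from f) =
    star b.unop • (show F from f) + star c.unop • (show F from f) by rw [star_add, add_smul]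
  zero_smul f := show star (0 : B) • (show F from f) = 0 by rw [star_zero, zero_smul]

theorem op_smul_mk {B F : Type u} [Ring B] [StarRing B] [AddCommGroup F] [Module B F]
    (b : B) (f : F) : MulOpposite.op b • mk f = mk (star b • f) := rfl

end ConjModule

/-- The cone `B_{≥0}` of positive elements: nonnegative real combinations of elements `b* b`. -/
def positiveCone (B : Type u) [Ring B] [StarRing B] [Algebra ℂ B] : Submodule NNReal B :=
  Submodule.span NNReal (Set.range fun b : B => star b * b)

/-- `b ∈ B_{>0} = B_{≥0} \ {0}`. -/
def IsStrictlyPositiveElt {B : Type u} [Ring B] [StarRing B] [Algebra ℂ B] (b : B) : Prop :=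
  b ∈ positiveCone B ∧ b ≠ 0

/-- `(F, h)` is an Hermitian module over the `*`-algebra `B`: the left `B`-module `F` is finitely
generated projective, `h : F̄ → ^∨F = {}_B Hom(F, B)` is an isomorphism of right `B`-modules, and
the pairing `h(f, k) = h(k̄)(f)` is conjugate symmetric and positive definite. The right action on
`^∨F` is `(φ b)(f) = φ(f) b`. -/
structure IsHermitianModule {B F : Type u} [Ring B] [StarRing B] [Algebra ℂ B] [AddCommGroup F]
    [Module B F] (h : ConjModule F ≃ₗ[Bᵐᵒᵖ] (F →ₗ[B] B)) : Prop where
  finite : Module.Finite B F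
  projective : Module.Projective B F
  conj_symm : ∀ f k : F, h (ConjModule.mk k) f = star (h (ConjModule.mk f) k)
  pos : ∀ f : F, f ≠ 0 → IsStrictlyPositiveElt (h (ConjModule.mk f) f)

end HermitianModule

/-! ## Differential calculi -/

/-- A differential calculus over `B`: a dg-algebra `(Ω^•, d)`, graded by `ℕ`, whose degree zero
part is identified with `B` through `ι`, and which is generated as an algebra by the elements
`b` and `db`, for `b ∈ B`. -/
structure DifferentialCalculus (B : Type u) [Ring B] [Algebra ℂ B] where
  /-- The algebra `Ω^•`. -/
  Form : Type u
  [ring : Ring Form]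
  [algebra : Algebra ℂ Form]
  /-- The homogeneous component `Ω^k`. -/
  deg : ℕ → Submodule ℂ Form
  [graded : GradedAlgebra deg]
  /-- The identification of `B` with `Ω^0`. -/
  ι : B →ₐ[ℂ] Form
  ι_injective : Function.Injective ι
  range_ι : LinearMap.range ι.toLinearMap = deg 0
  /-- The exterior derivative. -/
  d : Form →ₗ[ℂ] Form
  d_mem : ∀ k, ∀ ω ∈ deg k, d ω ∈ deg (k + 1)
  d_d : ∀ ω, d (d ω) = 0
  leibniz : ∀ k, ∀ ω ∈ deg k, ∀ ν, d (ω * ν) = d ω * ν + (-1) ^ k * (ω * d ν)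
  generated : Algebra.adjoin ℂ (Set.range ι ∪ Set.range fun b => d (ι b)) = ⊤

namespace DifferentialCalculus

attribute [instance] ring algebra graded

variable {B : Type u} [Ring B] [Algebra ℂ B] (C : DifferentialCalculus B)

/-- The left `B`-action `b ω`. -/
instance : Module B C.Form := Module.compHom C.Form C.ι.toRingHom

/-- The right `B`-action `ω b`. -/
instance : Module Bᵐᵒᵖ C.Form := Module.compHom C.Form C.ι.toRingHom.op

theorem smul_def (b : B) (ω : C.Form) : b • ω = C.ι b * ω := rfl

theorem op_smul_def (b : B) (ω : C.Form) : MulOpposite.op b • ω = ω * C.ι b := rfl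

instance : IsScalarTower ℂ B C.Form where
  smul_assoc z b ω := by rw [smul_def, smul_def, map_smul, smul_mul_assoc]

/-- The `ℂ`-linear isomorphism `B ≃ Ω^0`. -/
def baseEquiv : B ≃ₗ[ℂ] C.deg 0 :=
  (LinearEquiv.ofInjective C.ι.toLinearMap C.ι_injective).trans (LinearEquiv.ofEq _ _ C.range_ι)

/-- The degree zero component of a form, as an element of `B`. -/
def toBase : C.Form →ₗ[ℂ] B :=
  C.baseEquiv.symm.toLinearMap ∘ₗ DirectSum.component ℂ ℕ (fun k => C.deg k) 0 ∘ₗ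
    (DirectSum.decomposeLinearEquiv C.deg).toLinearMap

theorem ι_toBase {ω : C.Form} (h : ω ∈ C.deg 0) : C.ι (C.toBase ω) = ω := by
  have h1 : ∀ x : C.deg 0, C.ι (C.baseEquiv.symm x) = x := fun x => by
    obtain ⟨b, rfl⟩ := C.baseEquiv.surjective x
    rw [LinearEquiv.symm_apply_apply]
    rfl
  have h2 : C.toBase ω = C.baseEquiv.symm (DirectSum.decompose C.deg ω 0) := rfl
  rw [h2, h1, DirectSum.decompose_of_mem_same _ h]

theorem toBase_of_ne {k : ℕ} (hk : k ≠ 0) {ω : C.Form} (h : ω ∈ C.deg k) : C.toBase ω = 0 := by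
  have h2 : C.toBase ω = C.baseEquiv.symm (DirectSum.decompose C.deg ω 0) := rfl
  have h3 : DirectSum.decompose C.deg ω 0 = 0 :=
    Subtype.ext (DirectSum.decompose_of_mem_ne _ h hk)
  rw [h2, h3, map_zero]

/-- `Ω^•` is of total degree `m`: `Ω^m ≠ 0` and `Ω^k = 0` for `k > m`. -/
structure HasTotalDegree (m : ℕ) : Prop where
  ne_bot : C.deg m ≠ ⊥
  eq_bot : ∀ k, m < k → C.deg k = ⊥

end DifferentialCalculus

/-- A differential `*`-calculus over a `*`-algebra `B`: the `*`-map of `B` extends to a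
conjugate-linear involution of `Ω^•` commuting with `d` and satisfying
`(ω ∧ ν)* = (-1)^{kl} ν* ∧ ω*` for `ω ∈ Ω^k`, `ν ∈ Ω^l`. -/
structure StarCalculus (B : Type u) [Ring B] [StarRing B] [Algebra ℂ B] extends
    DifferentialCalculus B where
  /-- The `*`-map of forms. -/
  conj : Form →ₛₗ[starRingEnd ℂ] Form
  conj_conj : ∀ ω, conj (conj ω) = ω
  conj_ι : ∀ b, conj (ι b) = ι (star b)
  conj_d : ∀ ω, conj (d ω) = d (conj ω)
  conj_mul : ∀ k l, ∀ ω ∈ deg k, ∀ ν ∈ deg l,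
    conj (ω * ν) = (-1) ^ (k * l) * (conj ν * conj ω)

section Structures

variable {B : Type u} [Ring B] [StarRing B] [Algebra ℂ B]

/-- A complex structure: an `ℕ²`-algebra grading of `Ω^•` with `Ω^k = ⨁_{a+b=k} Ω^{(a,b)}` and
`(Ω^{(a,b)})* = Ω^{(b,a)}` (the inclusion suffices as `*` is an involution), such that `d = ∂ + ∂̄`
with `∂` of degree `(1,0)` and `∂̄` of degree `(0,1)`. -/
structure ComplexStructure (C : StarCalculus B) where
  /-- The component `Ω^{(a,b)}`. -/
  bideg : ℕ × ℕ → Submodule ℂ C.Form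
  [bigraded : GradedAlgebra bideg]
  deg_eq : ∀ k, C.deg k = ⨆ (p : ℕ × ℕ) (_ : p.1 + p.2 = k), bideg p
  conj_mem : ∀ a b, ∀ ω ∈ bideg (a, b), C.conj ω ∈ bideg (b, a)
  d_eq : ∃ del delbar : C.Form →ₗ[ℂ] C.Form,
    C.d = del + delbar ∧
      (∀ a b, ∀ ω ∈ bideg (a, b), del ω ∈ bideg (a + 1, b)) ∧
      (∀ a b, ∀ ω ∈ bideg (a, b), delbar ω ∈ bideg (a, b + 1))

attribute [instance] ComplexStructure.bigraded

/-- An Hermitian structure for a differential `*`-calculus of total degree `2n`: a complex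
structure together with a central real `(1,1)`-form `σ` such that the Lefschetz operator
`L = σ ∧ -` gives isomorphisms `L^{n-k} : Ω^k → Ω^{2n-k}` for `k = 0, …, n-1`. -/
structure HermitianStructure (C : StarCalculus B) (n : ℕ) extends ComplexStructure C where
  totalDegree : C.HasTotalDegree (2 * n)
  /-- The Hermitian form. -/
  σ : C.Form
  σ_mem : σ ∈ bideg (1, 1)
  σ_real : C.conj σ = σ
  σ_central : ∀ ω, σ * ω = ω * σ
  lefschetz : ∀ k < n, Set.BijOn (fun ω => (LinearMap.mulLeft ℂ σ ^ (n - k)) ω)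
    (C.deg k) (C.deg (2 * n - k))

/-- The coefficient `(-1)^{k(k+1)/2} i^{a-b} j! / (n-j-k)!`, with `k = a + b`, of the Weil
formula, to be used for `a + b + j ≤ n`. -/
def weilCoeff (n a b j : ℕ) : ℂ :=
  (-1) ^ ((a + b) * (a + b + 1) / 2) * Complex.I ^ ((a : ℤ) - (b : ℤ)) *
    ((j.factorial : ℂ) / ((n - j - (a + b)).factorial : ℂ))

theorem ComplexStructure.bideg_le {C : StarCalculus B} (X : ComplexStructure C) (a b : ℕ) :
    X.bideg (a, b) ≤ C.deg (a + b) := by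
  rw [X.deg_eq]
  exact le_iSup₂_of_le (a, b) rfl le_rfl

namespace HermitianStructure

variable {C : StarCalculus B} {n : ℕ} (H : HermitianStructure C n)

/-- The Lefschetz operator `L_σ(ω) = σ ∧ ω`. -/
def L : C.Form →ₗ[ℂ] C.Form := LinearMap.mulLeft ℂ H.σ

/-- Primitive `(a,b)`-forms: `{α ∈ Ω^{(a,b)} | L^{n-(a+b)+1} α = 0}`, to be used for
`a + b ≤ n`. -/
def primitive (a b : ℕ) : Submodule ℂ C.Form :=
  H.bideg (a, b) ⊓ LinearMap.ker (H.L ^ (n + 1 - (a + b)))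

theorem L_pow_apply (N : ℕ) (ω : C.Form) : (H.L ^ N) ω = H.σ ^ N * ω := by
  rw [L, LinearMap.pow_mulLeft, LinearMap.mulLeft_apply]

theorem σ_pow_mem (N : ℕ) : H.σ ^ N ∈ H.bideg (N, N) := by
  have := SetLike.pow_mem_graded N H.σ_mem
  simpa using this

theorem L_pow_mem_bideg (N : ℕ) {a b : ℕ} {ω : C.Form} (h : ω ∈ H.bideg (a, b)) :
    (H.L ^ N) ω ∈ H.bideg (N + a, N + b) := by
  rw [L_pow_apply]
  exact SetLike.mul_mem_graded (H.σ_pow_mem N) h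

theorem L_pow_mem_deg (N : ℕ) {k : ℕ} {ω : C.Form} (h : ω ∈ C.deg k) :
    (H.L ^ N) ω ∈ C.deg (2 * N + k) := by
  rw [L_pow_apply]
  refine SetLike.mul_mem_graded ?_ h
  have := H.bideg_le _ _ (H.σ_pow_mem N)
  rwa [← two_mul] at this

theorem decompose_L_pow (N : ℕ) (ω : C.Form) (a b : ℕ) :
    (DirectSum.decompose H.bideg ((H.L ^ N) ω) (N + a, N + b) : C.Form) =
      (H.L ^ N) (DirectSum.decompose H.bideg ω (a, b)) := by
  rw [L_pow_apply, L_pow_apply]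
  exact DirectSum.coe_decompose_mul_add_of_left_mem H.bideg (H.σ_pow_mem N) (j := (a, b))

theorem L_pow_eq_zero {a b : ℕ} {α : C.Form} (h : α ∈ H.primitive a b) {N : ℕ}
    (hN : n + 1 ≤ N + (a + b)) : (H.L ^ N) α = 0 := by
  obtain ⟨M, rfl⟩ : ∃ M, N = M + (n + 1 - (a + b)) := ⟨N - (n + 1 - (a + b)), by omega⟩
  rw [pow_add, Module.End.mul_apply, LinearMap.mem_ker.1 h.2, map_zero]

/-- Index set of the Lefschetz decomposition: triples `(a, b, j)` with `a + b + j ≤ n`. -/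
abbrev Idx (n : ℕ) : Type := {p : ℕ × ℕ × ℕ // p.1 + p.2.1 + p.2.2 ≤ n}

/-- The map `⨁ P^{(a,b)} → Ω`, `α ↦ L^j α` on the summand `(a, b, j)`. -/
def lefschetzMap :
    (DirectSum (Idx n) fun i => H.primitive i.1.1 i.1.2.1) →ₗ[ℂ] C.Form :=
  DirectSum.toModule ℂ (Idx n) C.Form fun i =>
    (H.L ^ i.1.2.2) ∘ₗ (H.primitive i.1.1 i.1.2.1).subtype

theorem lefschetzMap_of (i : Idx n) (α : H.primitive i.1.1 i.1.2.1) :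
    H.lefschetzMap (DirectSum.lof ℂ (Idx n) (fun i => H.primitive i.1.1 i.1.2.1) i α) =
      (H.L ^ i.1.2.2) α := by
  rw [lefschetzMap, DirectSum.toModule_lof]
  rfl

theorem L_pow_injOn {k : ℕ} (hk : k ≤ n) {ω : C.Form} (h : ω ∈ C.deg k)
    (h0 : (H.L ^ (n - k)) ω = 0) : ω = 0 := by
  rcases hk.lt_or_eq with hk | rfl
  · refine (H.lefschetz k hk).injOn h (C.deg k).zero_mem ?_
    simpa [L] using h0
  · simpa using h0

theorem lefschetzMap_eq_zero (x : DirectSum (Idx n) fun i => H.primitive i.1.1 i.1.2.1)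
    (hx : H.lefschetzMap x = 0) : x = 0 := by
  classical
  by_contra hne
  obtain ⟨i₀, hi₀, hmax⟩ := Finset.exists_max_image (DFinsupp.support x) (fun i => i.1.2.2)
    (Finset.nonempty_iff_ne_empty.2 fun h => hne (DFinsupp.support_eq_empty.1 h))
  obtain ⟨⟨a, b, j⟩, hi⟩ := i₀
  simp only at hi hmax
  set N := n - (a + b) - j with hN
  have key : ∀ i ∈ DFinsupp.support x, i ≠ ⟨(a, b, j), hi⟩ →
      (H.L ^ N) (DirectSum.decompose H.bideg ((H.L ^ i.1.2.2) (x i)) (j + a, j + b)) = 0 := by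
    rintro ⟨⟨a', b', j'⟩, hi'⟩ hmem hne'
    have hj := hmax _ hmem
    simp only at hj hi' ⊢
    have hb := H.L_pow_mem_bideg j' (x ⟨(a', b', j'), hi'⟩).2.1
    by_cases heq : ((j' + a', j' + b') : ℕ × ℕ) = (j + a, j + b)
    · simp only [Prod.mk.injEq] at heq
      rw [← Prod.mk.injEq] at heq
      rw [heq] at hb
      rw [DirectSum.decompose_of_mem_same _ hb, ← Module.End.mul_apply, ← pow_add]
      refine H.L_pow_eq_zero (x ⟨(a', b', j'), hi'⟩).2 ?_
      simp only [Prod.mk.injEq] at heq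
      have : j' ≠ j := by
        rintro rfl
        apply hne'
        ext <;> simp <;> omega
      simp only
      omega
    · rw [DirectSum.decompose_of_mem_ne _ hb heq, map_zero]
  have hsum : H.lefschetzMap x = ∑ i ∈ DFinsupp.support x, (H.L ^ i.1.2.2) (x i : C.Form) := by
    conv_lhs => rw [← DirectSum.sum_support_of x]
    rw [map_sum]
    exact Finset.sum_congr rfl fun i _ => H.lefschetzMap_of i (x i)
  have h1 : (H.L ^ N) (DirectSum.decompose H.bideg (H.lefschetzMap x) (j + a, j + b)) = 0 := by
    rw [hx]; simp
  rw [hsum, DirectSum.decompose_sum, DFinsupp.finsetSum_apply, AddSubmonoidClass.coe_finsetSum,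
    map_sum, Finset.sum_eq_single_of_mem _ hi₀ key] at h1
  have hb := H.L_pow_mem_bideg j (x ⟨(a, b, j), hi⟩).2.1
  rw [DirectSum.decompose_of_mem_same _ hb, ← Module.End.mul_apply, ← pow_add] at h1
  have hNj : N + j = n - (a + b) := by omega
  rw [hNj] at h1
  have h2 := H.L_pow_injOn (k := a + b) (by omega) (H.bideg_le _ _ (x ⟨(a, b, j), hi⟩).2.1) h1
  exact (DFinsupp.mem_support_iff.1 hi₀) (Subtype.ext h2)

theorem lefschetzMap_injective : Function.Injective H.lefschetzMap := by
  intro x y hxy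
  have h := H.lefschetzMap_eq_zero (x + (-1 : ℂ) • y) (by
    rw [map_add, map_smul, hxy, neg_smul, one_smul, add_neg_cancel])
  have h2 : (-1 : ℂ) • y + y = 0 := by
    nth_rewrite 2 [← one_smul ℂ y]
    rw [← add_smul, neg_add_cancel, zero_smul]
  calc x = x + ((-1 : ℂ) • y + y) := by rw [h2, add_zero]
    _ = y := by rw [← add_assoc, h, zero_add]

theorem L_pow_mem_range (N : ℕ) {a b : ℕ} {α : C.Form} (h : α ∈ H.primitive a b) :
    (H.L ^ N) α ∈ LinearMap.range H.lefschetzMap := by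
  by_cases hN : a + b + N ≤ n
  · exact ⟨_, H.lefschetzMap_of ⟨(a, b, N), hN⟩ ⟨α, h⟩⟩
  · rw [H.L_pow_eq_zero h (by omega)]
    exact Submodule.zero_mem _

theorem L_pow_range (N : ℕ) {ω : C.Form} (h : ω ∈ LinearMap.range H.lefschetzMap) :
    (H.L ^ N) ω ∈ LinearMap.range H.lefschetzMap := by
  obtain ⟨x, rfl⟩ := h
  induction x using DirectSum.induction_on with
  | zero => simp
  | of i α =>
    have := H.lefschetzMap_of i α
    rw [DirectSum.lof_eq_of] at this
    rw [this, ← Module.End.mul_apply, ← pow_add]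
    exact H.L_pow_mem_range _ α.2
  | add x y hx hy =>
    rw [map_add, map_add]
    exact Submodule.add_mem _ hx hy

/-- Elements of `Ω^k`, `k ≤ n`, killed by `L^{n-k+1}` are sums of primitive `(a,b)`-forms. -/
theorem mem_range_of_L_pow_eq_zero {k : ℕ} {ω : C.Form} (h : ω ∈ C.deg k)
    (h0 : (H.L ^ (n + 1 - k)) ω = 0) : ω ∈ LinearMap.range H.lefschetzMap := by
  classical
  have hdec : ∀ p : ℕ × ℕ, p.1 + p.2 ≠ k → (DirectSum.decompose H.bideg ω p : C.Form) = 0 := by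
    intro p hp
    have hle : C.deg k ≤ LinearMap.ker ((H.bideg p).subtype ∘ₗ
        DirectSum.component ℂ (ℕ × ℕ) (fun q => H.bideg q) p ∘ₗ
          (DirectSum.decomposeLinearEquiv H.bideg).toLinearMap) := by
      rw [H.deg_eq]
      refine iSup₂_le fun q hq x hx => ?_
      exact DirectSum.decompose_of_mem_ne H.bideg hx (by rintro rfl; exact hp hq)
    exact hle h
  rw [← DirectSum.sum_support_decompose H.bideg ω]
  refine Submodule.sum_mem _ fun p hp => ?_
  obtain ⟨a, b⟩ := p
  by_cases hk : a + b = k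
  · have hprim : (DirectSum.decompose H.bideg ω (a, b) : C.Form) ∈ H.primitive a b := by
      refine ⟨SetLike.coe_mem _, ?_⟩
      have h1 := H.decompose_L_pow (n + 1 - (a + b)) ω a b
      rw [hk, h0] at h1
      rw [hk, SetLike.mem_coe, LinearMap.mem_ker, ← h1]
      simp
    simpa using H.L_pow_mem_range 0 hprim
  · rw [hdec _ hk]
    exact Submodule.zero_mem _

theorem deg_le_range (k : ℕ) (hk : k ≤ n) :
    C.deg k ≤ LinearMap.range H.lefschetzMap := by
  induction k using Nat.strong_induction_on with
  | _ k ih =>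
    intro ω hω
    have hL := H.L_pow_mem_deg (n + 1 - k) hω
    by_cases hk2 : k < 2
    · rw [H.totalDegree.eq_bot _ (by omega), Submodule.mem_bot] at hL
      exact H.mem_range_of_L_pow_eq_zero hω hL
    · have hdeg : 2 * (n + 1 - k) + k = 2 * n - (k - 2) := by omega
      rw [hdeg] at hL
      obtain ⟨η, hη, hηe⟩ := (H.lefschetz (k - 2) (by omega)).surjOn hL
      have hηe' : (H.L ^ (n - (k - 2))) η = (H.L ^ (n + 1 - k)) ω := hηe
      have hLη := H.L_pow_mem_deg 1 hη
      have e1 : 2 * 1 + (k - 2) = k := by omega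
      rw [e1] at hLη
      have e2 : n - (k - 2) = (n + 1 - k) + 1 := by omega
      have h1 : ω - (H.L ^ 1) η ∈ LinearMap.range H.lefschetzMap := by
        refine H.mem_range_of_L_pow_eq_zero (Submodule.sub_mem _ hω hLη) ?_
        rw [map_sub, ← Module.End.mul_apply, ← pow_add, ← e2, hηe', sub_self]
      have h2 := H.L_pow_range 1 (ih (k - 2) (by omega) (by omega) hη)
      simpa using Submodule.add_mem _ h1 h2

theorem lefschetzMap_surjective : Function.Surjective H.lefschetzMap := by
  classical
  have hdeg : ∀ k, C.deg k ≤ LinearMap.range H.lefschetzMap := by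
    intro k
    by_cases hk : k ≤ n
    · exact H.deg_le_range k hk
    · by_cases hk2 : k ≤ 2 * n
      · intro ω hω
        have e : 2 * n - (2 * n - k) = k := by omega
        obtain ⟨η, hη, rfl⟩ := (H.lefschetz (2 * n - k) (by omega)).surjOn (by rwa [e])
        exact H.L_pow_range _ (H.deg_le_range _ (by omega) hη)
      · rw [H.totalDegree.eq_bot _ (by omega)]
        exact bot_le
  intro ω
  rw [← LinearMap.mem_range, ← DirectSum.sum_support_decompose C.deg ω]
  exact Submodule.sum_mem _ fun k _ => hdeg k (SetLike.coe_mem _)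

/-- The Lefschetz decomposition `⨁_{a+b+j ≤ n} P^{(a,b)} ≃ Ω`, `α ↦ L^j α`. -/
def lefschetzEquiv :
    (DirectSum (Idx n) fun i => H.primitive i.1.1 i.1.2.1) ≃ₗ[ℂ] C.Form :=
  LinearEquiv.ofBijective H.lefschetzMap ⟨H.lefschetzMap_injective, H.lefschetzMap_surjective⟩

/-- The Hodge map `∗_σ`, defined by the Weil formula
`∗(L^j α) = (-1)^{k(k+1)/2} i^{a-b} (j! / (n-j-k)!) L^{n-j-k} α` for primitive `α ∈ P^{(a,b)}`,
`k = a + b`, through the Lefschetz decomposition; see `hodge_L_pow` and `hodge_unique`. -/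
def hodge : C.Form →ₗ[ℂ] C.Form :=
  (DirectSum.toModule ℂ (Idx n) C.Form fun i =>
    weilCoeff n i.1.1 i.1.2.1 i.1.2.2 •
      ((H.L ^ (n - i.1.2.2 - (i.1.1 + i.1.2.1))) ∘ₗ (H.primitive i.1.1 i.1.2.1).subtype)) ∘ₗ
    H.lefschetzEquiv.symm.toLinearMap

theorem hodge_L_pow {a b j : ℕ} (h : a + b + j ≤ n) {α : C.Form} (hα : α ∈ H.primitive a b) :
    H.hodge ((H.L ^ j) α) = weilCoeff n a b j • (H.L ^ (n - j - (a + b))) α := by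
  have h1 := H.lefschetzMap_of ⟨(a, b, j), h⟩ ⟨α, hα⟩
  have h2 : H.lefschetzEquiv.symm ((H.L ^ j) α) =
      DirectSum.lof ℂ (Idx n) (fun i => H.primitive i.1.1 i.1.2.1) ⟨(a, b, j), h⟩ ⟨α, hα⟩ := by
    rw [LinearEquiv.symm_apply_eq]
    exact h1.symm
  rw [hodge, LinearMap.comp_apply, LinearEquiv.coe_coe, h2, DirectSum.toModule_lof]
  rfl

theorem hom_ext_of_L_pow {T T' : C.Form →ₗ[ℂ] C.Form}
    (hT : ∀ a b j, a + b + j ≤ n → ∀ α ∈ H.primitive a b, T ((H.L ^ j) α) = T' ((H.L ^ j) α)) :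
    T = T' := by
  have h : T ∘ₗ H.lefschetzMap = T' ∘ₗ H.lefschetzMap := by
    refine DirectSum.linearMap_ext ℂ fun i => LinearMap.ext fun α => ?_
    simp only [LinearMap.comp_apply, H.lefschetzMap_of]
    exact hT _ _ _ i.2 _ α.2
  ext ω
  obtain ⟨x, rfl⟩ := H.lefschetzMap_surjective ω
  exact LinearMap.congr_fun h x

theorem hodge_unique (T : C.Form →ₗ[ℂ] C.Form)
    (hT : ∀ a b j, a + b + j ≤ n → ∀ α ∈ H.primitive a b,
      T ((H.L ^ j) α) = weilCoeff n a b j • (H.L ^ (n - j - (a + b))) α) : T = H.hodge :=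
  H.hom_ext_of_L_pow fun a b j h α hα => by rw [hT a b j h α hα, H.hodge_L_pow h hα]

/-- `∗_σ(Ω^k) ⊆ Ω^{2n-k}`. -/
theorem hodge_mem_deg {k : ℕ} {ω : C.Form} (hω : ω ∈ C.deg k) :
    H.hodge ω ∈ C.deg (2 * n - k) := by
  classical
  have key : ∀ ω : C.Form, H.hodge (DirectSum.decompose C.deg ω k) ∈ C.deg (2 * n - k) := by
    intro ω
    obtain ⟨x, rfl⟩ := H.lefschetzMap_surjective ω
    induction x using DirectSum.induction_on with
    | zero => simp
    | of i α =>
      have h1 := H.lefschetzMap_of i α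
      rw [DirectSum.lof_eq_of] at h1
      rw [h1]
      obtain ⟨⟨a, b, j⟩, hi⟩ := i
      simp only at hi α ⊢
      have h2 := H.L_pow_mem_deg j (H.bideg_le _ _ α.2.1)
      by_cases hk : 2 * j + (a + b) = k
      · rw [hk] at h2
        rw [DirectSum.decompose_of_mem_same _ h2, H.hodge_L_pow hi α.2]
        refine Submodule.smul_mem _ _ ?_
        have h3 := H.L_pow_mem_deg (n - j - (a + b)) (H.bideg_le _ _ α.2.1)
        have e : 2 * (n - j - (a + b)) + (a + b) = 2 * n - k := by omega
        rwa [e] at h3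
      · rw [DirectSum.decompose_of_mem_ne _ h2 hk, map_zero]
        exact Submodule.zero_mem _
    | add x y hx hy =>
      rw [map_add, DirectSum.decompose_add, DirectSum.add_apply, Submodule.coe_add, map_add]
      exact Submodule.add_mem _ hx hy
  have := key ω
  rwa [DirectSum.decompose_of_mem_same _ hω] at this

/-- The metric `g_σ : Ω^• × Ω^• → B`: the degree zero component of `∗(ω ∧ ∗(ν*))`. For
`ω, ν ∈ Ω^k` this is `∗(ω ∧ ∗(ν*))` itself (`ι_metric`) and it vanishes for `ω ∈ Ω^k`, `ν ∈ Ω^l`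
with `k ≠ l` (`metric_of_ne`). -/
def metric (ω ν : C.Form) : B := C.toBase (H.hodge (ω * H.hodge (C.conj ν)))

theorem conj_mem_deg (H : HermitianStructure C n) {k : ℕ} {ω : C.Form} (hω : ω ∈ C.deg k) : C.conj ω ∈ C.deg k := by
  have hle : C.deg k ≤ (C.deg k).comap C.conj := by
    refine (H.deg_eq k).le.trans ?_
    refine iSup₂_le fun p hp ω hω => ?_
    obtain ⟨a, b⟩ := p
    have := H.bideg_le _ _ (H.conj_mem a b ω hω)
    rw [Submodule.mem_comap, ← hp, add_comm]
    exact this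
  exact hle hω

theorem ι_metric {k : ℕ} {ω ν : C.Form} (hω : ω ∈ C.deg k) (hν : ν ∈ C.deg k) :
    C.ι (H.metric ω ν) = H.hodge (ω * H.hodge (C.conj ν)) := by
  refine C.ι_toBase ?_
  by_cases hk : k ≤ 2 * n
  · have h1 := SetLike.mul_mem_graded hω (H.hodge_mem_deg (H.conj_mem_deg hν))
    have e : k + (2 * n - k) = 2 * n := by omega
    rw [e] at h1
    have := H.hodge_mem_deg h1
    rwa [Nat.sub_self] at this
  · rw [H.totalDegree.eq_bot _ (by omega), Submodule.mem_bot] at hω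
    simp [hω]

theorem metric_of_ne {k l : ℕ} (hkl : k ≠ l) {ω ν : C.Form} (hω : ω ∈ C.deg k)
    (hν : ν ∈ C.deg l) : H.metric ω ν = 0 := by
  have hz : ∀ m, 2 * n < m → ∀ x ∈ C.deg m, x = 0 := fun m hm x hx => by
    rwa [H.totalDegree.eq_bot _ hm, Submodule.mem_bot] at hx
  by_cases hl : l ≤ 2 * n
  · have h1 := SetLike.mul_mem_graded hω (H.hodge_mem_deg (H.conj_mem_deg hν))
    by_cases hkl' : 2 * n < k + (2 * n - l)
    · rw [metric, hz _ hkl' _ h1, map_zero, map_zero]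
    · exact C.toBase_of_ne (by omega) (H.hodge_mem_deg h1)
  · rw [metric, hz _ (by omega) _ hν]
    simp

/-- The Hermitian structure is positive definite: `g_σ(ω, ω) ∈ B_{>0}` for all `ω ≠ 0`. -/
def IsPositiveDefinite : Prop :=
  ∀ ω : C.Form, ω ≠ 0 → IsStrictlyPositiveElt (H.metric ω ω)

end HermitianStructure

end Structures

/-! ## Covariance -/

section Covariance

variable {A : Type u} [Ring A] [HopfAlgebra ℂ A] [StarRing A] [StarModule ℂ A]
variable {B : StarSubalgebra ℂ A}

/-- The calculus over `B ⊆ A` is (left `A`-)covariant, with coaction `δ`: the coaction `Δ` of `B`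
extends to an algebra map `δ : Ω^• → A ⊗ Ω^•` which is a left `A`-comodule structure and for which
`d` is a comodule map. (Such a `δ` is unique.) -/
structure DifferentialCalculus.IsCovariant (C : DifferentialCalculus B)
    (δ : C.Form →ₐ[ℂ] A ⊗[ℂ] C.Form) : Prop where
  coaction : IsLeftCoaction δ.toLinearMap
  extends_comul : ∀ b : B, ∃ t : A ⊗[ℂ] B,
    LinearMap.lTensor A (incl B) t = Coalgebra.comul (R := ℂ) (b : A) ∧
      δ (C.ι b) = LinearMap.lTensor A C.ι.toLinearMap t
  d_comodule : ∀ ω, δ (C.d ω) = LinearMap.lTensor A C.d (δ ω)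

/-- The Hermitian structure is covariant: each `Ω^{(a,b)}` is a left `A`-subcomodule, and the
Hermitian form is left `A`-coinvariant. -/
structure HermitianStructure.IsCovariant {C : StarCalculus B} {n : ℕ}
    (H : HermitianStructure C n) (δ : C.Form →ₐ[ℂ] A ⊗[ℂ] C.Form) : Prop where
  bideg_coaction : ∀ p, ∀ ω ∈ H.bideg p,
    δ ω ∈ LinearMap.range (LinearMap.lTensor A (H.bideg p).subtype)
  σ_coinvariant : δ H.σ = 1 ⊗ₜ[ℂ] H.σ

end Covariance

end

end NCGeom

/-! Write ∫ω for the degree zero part of `hodge ω`, so that g(ω, ν) = ∫ ω ∧ ∗(ν*). This is a map of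
`B`-bimodules, since ∗ commutes with every bigraded map commuting with σ. Conjugate symmetry is
formal. The map ∗ commutes with the involution (`hodge_conj`), and it is self-adjoint for ∫ up to a
degree sign (`integral_mul_hodge`). The latter is checked on the Lefschetz decomposition, where
primitivity and bidegree kill all but the matching terms. Positivity makes ω̄ ↦ g(-, ω) injective,
so what remains is projectivity and surjectivity. Both follow from dual bases: finitely many u_j,
z_j with ω = ∑ g(ω, u_j) z_j for all ω.

The dual bases come from Takeuchi-style descent. Since σ is coinvariant and the bigrading is by
subcomodules, ∫ is also a comodule map (`isInvariantIntegral`). The fibre V = Ω/B⁺Ω is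
finite-dimensional, and both actions of `B` on it go through ε, so ε(∫ x w) defines a pairing on V.
By `fibreMk_eq_zero` it is nondegenerate: the element S(x₍₋₁₎) ⊗ x₍₀₎ of A ⊗_B Ω depends only on [x]
and determines it, and flatness turns the nondegeneracy of ∫ x w, which positivity gives, into its
vanishing criterion. Finite dimension then yields dual bases x_j, y_j of V.

To lift them, take right generators w_i and let P be the left `B`-submodule of tuples spanned by all
(y ∫(x w_i))_i. Invariance and the antipode identities give ∑_j S(x_j₍₋₁₎) S(y_j₍₋₁₎) ⊗ y_j₍₀₎
∫(x_j₍₀₎ w_i) = 1 ⊗ w_i in A ⊗_B Ω. So 1 ⊗ w comes from A ⊗_B P, and faithful flatness puts w in P.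
That expresses all w_i by one finite system, and right linearity extends it to Ω
(`exists_dual_basis`). -/

namespace NCGeom

/-! ### Hodge map, integral and conjugate symmetry of the metric -/

section FormalHodgeTheory

namespace DifferentialCalculus

variable {B : Type u} [Ring B] [Algebra ℂ B] (C : DifferentialCalculus B)

theorem ι_mem (b : B) : C.ι b ∈ C.deg 0 := by
  rw [← C.range_ι]
  exact ⟨b, rfl⟩

theorem ι_toBase_eq_decompose (ω : C.Form) :
    C.ι (C.toBase ω) = DirectSum.decompose C.deg ω 0 := by
  have h : C.toBase ω = C.toBase (DirectSum.decompose C.deg ω 0 : C.Form) := by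
    change C.baseEquiv.symm (DirectSum.decompose C.deg ω 0) =
      C.baseEquiv.symm (DirectSum.decompose C.deg (DirectSum.decompose C.deg ω 0 : C.Form) 0)
    congr 1
    exact Subtype.ext (DirectSum.decompose_of_mem_same _ (SetLike.coe_mem _)).symm
  rw [h, C.ι_toBase (SetLike.coe_mem _)]

theorem toBase_ι (b : B) : C.toBase (C.ι b) = b :=
  C.ι_injective (C.ι_toBase (C.ι_mem b))

theorem toBase_ι_mul (b : B) (ω : C.Form) : C.toBase (C.ι b * ω) = b * C.toBase ω := by
  apply C.ι_injective
  rw [map_mul C.ι, ι_toBase_eq_decompose, ι_toBase_eq_decompose,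
    DirectSum.coe_decompose_mul_of_left_mem_zero C.deg (C.ι_mem b)]

theorem toBase_mul_ι (ω : C.Form) (b : B) : C.toBase (ω * C.ι b) = C.toBase ω * b := by
  apply C.ι_injective
  rw [map_mul C.ι, ι_toBase_eq_decompose, ι_toBase_eq_decompose,
    DirectSum.coe_decompose_mul_of_right_mem_zero C.deg (C.ι_mem b)]

/-- The grading involution `ω ↦ (-1)^k ω` for `ω ∈ Ω^k`. -/
noncomputable def gradeInvolution : C.Form →ₗ[ℂ] C.Form :=
  (DirectSum.toModule ℂ ℕ C.Form fun k => (-1 : ℂ) ^ k • (C.deg k).subtype) ∘ₗ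
    (DirectSum.decomposeLinearEquiv C.deg).toLinearMap

theorem gradeInvolution_of_mem {k : ℕ} {ω : C.Form} (h : ω ∈ C.deg k) :
    C.gradeInvolution ω = (-1 : ℂ) ^ k • ω := by
  classical
  lift ω to C.deg k using h
  change DirectSum.toModule ℂ ℕ C.Form _ (DirectSum.decompose C.deg (ω : C.Form)) = _
  rw [DirectSum.decompose_coe, ← DirectSum.lof_eq_of ℂ, DirectSum.toModule_lof]
  rfl

/-- Linear maps agreeing on homogeneous forms are equal. -/
theorem hom_ext_of_deg {M : Type*} [AddCommMonoid M] {S T : C.Form →+ M}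
    (h : ∀ k, ∀ ω ∈ C.deg k, S ω = T ω) : S = T := by
  ext ω
  induction ω using DirectSum.Decomposition.inductionOn C.deg with
  | zero => simp
  | homogeneous m => exact h _ _ m.2
  | add x y hx hy => rw [map_add, map_add, hx, hy]

theorem neg_one_pow_mul_eq_smul (k : ℕ) (ω : C.Form) :
    (-1 : C.Form) ^ k * ω = (-1 : ℂ) ^ k • ω := by
  rcases Nat.even_or_odd k with hk | hk <;> simp [hk.neg_one_pow]

theorem gradeInvolution_gradeInvolution (ω : C.Form) :
    C.gradeInvolution (C.gradeInvolution ω) = ω := by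
  have := C.hom_ext_of_deg
    (S := (C.gradeInvolution ∘ₗ C.gradeInvolution).toAddMonoidHom) (T := AddMonoidHom.id _)
    fun k ω hω => by
      have h := C.gradeInvolution_of_mem hω
      change C.gradeInvolution (C.gradeInvolution ω) = ω
      rw [h, map_smul, h, smul_smul, ← mul_pow]
      simp
  exact DFunLike.congr_fun this ω

end DifferentialCalculus

variable {B : Type u} [Ring B] [StarRing B] [Algebra ℂ B]

theorem StarCalculus.conj_ι_mul (C : StarCalculus B) (b : B) (ω : C.Form) :
    C.conj (C.ι b * ω) = C.conj ω * C.ι (star b) := by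
  have := C.hom_ext_of_deg
    (S := C.conj.toAddMonoidHom.comp (AddMonoidHom.mulLeft (C.ι b)))
    (T := (AddMonoidHom.mulRight (C.ι (star b))).comp C.conj.toAddMonoidHom)
    fun k ω hω => by
      change C.conj (C.ι b * ω) = C.conj ω * C.ι (star b)
      rw [C.conj_mul 0 k _ (C.ι_mem b) _ hω, C.conj_ι]
      simp
  exact DFunLike.congr_fun this ω

theorem StarCalculus.conj_mul_ι (C : StarCalculus B) (ω : C.Form) (b : B) :
    C.conj (ω * C.ι b) = C.ι (star b) * C.conj ω := by
  have h := congr_arg C.conj (C.conj_ι_mul (star b) (C.conj ω))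
  rw [C.conj_conj, C.conj_conj, star_star] at h
  exact h.symm

namespace HermitianStructure

variable {C : StarCalculus B} {n : ℕ} (H : HermitianStructure C n)

theorem toBase_conj (H : HermitianStructure C n) (ω : C.Form) : C.toBase (C.conj ω) = star (C.toBase ω) := by
  have := C.hom_ext_of_deg
    (S := C.toBase.toAddMonoidHom.comp C.conj.toAddMonoidHom)
    (T := (starAddEquiv : B ≃+ B).toAddMonoidHom.comp C.toBase.toAddMonoidHom)
    fun k ω hω => by
      change C.toBase (C.conj ω) = star (C.toBase ω)
      rcases eq_or_ne k 0 with rfl | hk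
      · rw [← C.range_ι] at hω
        obtain ⟨b, rfl⟩ := hω
        change C.toBase (C.conj (C.ι b)) = star (C.toBase (C.ι b))
        rw [C.conj_ι, C.toBase_ι, C.toBase_ι]
      · rw [C.toBase_of_ne hk hω, C.toBase_of_ne hk (H.conj_mem_deg hω), star_zero]
  exact DFunLike.congr_fun this ω

theorem ι_mem_bideg (b : B) : C.ι b ∈ H.bideg (0, 0) := by
  have h : C.deg 0 ≤ H.bideg (0, 0) := by
    rw [H.deg_eq]
    refine iSup₂_le ?_
    rintro ⟨p, q⟩ hp
    obtain ⟨rfl, rfl⟩ : p = 0 ∧ q = 0 := by simpa using hp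
    exact le_rfl
  exact h (C.ι_mem b)

theorem map_L_pow {T : C.Form →ₗ[ℂ] C.Form} (hL : ∀ ω, T (H.σ * ω) = H.σ * T ω) (N : ℕ)
    (ω : C.Form) : T ((H.L ^ N) ω) = (H.L ^ N) (T ω) := by
  have h : Commute T H.L := LinearMap.ext hL
  exact LinearMap.congr_fun (h.pow_right N) ω

/-- The Hodge map commutes with every bigraded linear map that commutes with `σ`. -/
theorem hodge_comm {T : C.Form →ₗ[ℂ] C.Form} (hL : ∀ ω, T (H.σ * ω) = H.σ * T ω)
    (hb : ∀ p, ∀ ω ∈ H.bideg p, T ω ∈ H.bideg p) (ω : C.Form) :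
    H.hodge (T ω) = T (H.hodge ω) := by
  have : H.hodge ∘ₗ T = T ∘ₗ H.hodge := by
    refine H.hom_ext_of_L_pow fun a b j h α hα => ?_
    have hT : T α ∈ H.primitive a b := by
      refine ⟨hb _ _ hα.1, ?_⟩
      rw [SetLike.mem_coe, LinearMap.mem_ker, ← H.map_L_pow hL, LinearMap.mem_ker.1 hα.2, map_zero]
    rw [LinearMap.comp_apply, LinearMap.comp_apply, H.map_L_pow hL, H.hodge_L_pow h hT,
      H.hodge_L_pow h hα, map_smul, H.map_L_pow hL]
  exact LinearMap.congr_fun this ω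

/-- Elements of `B` have bidegree (0, 0) and commute with the central form σ, so `hodge_comm`
applies. -/
theorem hodge_ι_mul (b : B) (ω : C.Form) : H.hodge (C.ι b * ω) = C.ι b * H.hodge ω := by
  refine H.hodge_comm (T := LinearMap.mulLeft ℂ (C.ι b)) (fun ω => ?_) (fun p ω hω => ?_) ω
  · simp only [LinearMap.mulLeft_apply]
    rw [← mul_assoc, ← H.σ_central, mul_assoc]
  · simpa only [Prod.mk_zero_zero, zero_add, LinearMap.mulLeft_apply] using SetLike.mul_mem_graded (H.ι_mem_bideg b) hω

theorem hodge_mul_ι (ω : C.Form) (b : B) : H.hodge (ω * C.ι b) = H.hodge ω * C.ι b := by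
  refine H.hodge_comm (T := LinearMap.mulRight ℂ (C.ι b)) (fun ω => ?_) (fun p ω hω => ?_) ω
  · simp only [LinearMap.mulRight_apply]
    rw [mul_assoc]
  · simpa only [Prod.mk_zero_zero, add_zero, LinearMap.mulRight_apply] using SetLike.mul_mem_graded hω (H.ι_mem_bideg b)

/-- The form σ is real, central and of even degree, so neither a sign nor an order reversal
survives. -/
theorem conj_σ_mul (ω : C.Form) : C.conj (H.σ * ω) = H.σ * C.conj ω := by
  have := C.hom_ext_of_deg
    (S := C.conj.toAddMonoidHom.comp (AddMonoidHom.mulLeft H.σ))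
    (T := (AddMonoidHom.mulLeft H.σ).comp C.conj.toAddMonoidHom)
    fun k ω hω => by
      change C.conj (H.σ * ω) = H.σ * C.conj ω
      rw [C.conj_mul 2 k _ (H.bideg_le 1 1 H.σ_mem) _ hω, H.σ_real, H.σ_central, pow_mul]
      simp
  exact DFunLike.congr_fun this ω

theorem conj_L_pow (N : ℕ) (ω : C.Form) : C.conj ((H.L ^ N) ω) = (H.L ^ N) (C.conj ω) := by
  induction N with
  | zero => simp
  | succ N ih =>
    rw [pow_succ', Module.End.mul_apply, Module.End.mul_apply, ← ih]
    exact H.conj_σ_mul _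

theorem conj_mem_primitive {a b : ℕ} {α : C.Form} (hα : α ∈ H.primitive a b) :
    C.conj α ∈ H.primitive b a := by
  refine ⟨H.conj_mem _ _ _ hα.1, ?_⟩
  rw [SetLike.mem_coe, LinearMap.mem_ker, ← H.conj_L_pow, add_comm b a,
    LinearMap.mem_ker.1 hα.2, map_zero]

/-- Conjugation sends i to its inverse and hence i^(a-b) to i^(b-a); the other factors are real and
depend only on a + b and j. -/
theorem star_weilCoeff (n a b j : ℕ) :
    starRingEnd ℂ (weilCoeff n a b j) = weilCoeff n b a j := by
  simp only [weilCoeff, map_mul, map_pow, map_neg, map_one, map_zpow₀, Complex.conj_I, map_div₀,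
    Complex.conj_natCast]
  rw [add_comm b a, ← Complex.inv_I, inv_zpow', neg_sub]

theorem weilCoeff_ne_zero (n a b j : ℕ) : weilCoeff n a b j ≠ 0 := by
  simp [weilCoeff, Nat.factorial_ne_zero, zpow_ne_zero]

/-- The conjugate of ∗ by the involution is again ℂ-linear and satisfies the Weil formula, so
uniqueness identifies it with ∗. -/
theorem hodge_conj (ω : C.Form) : H.hodge (C.conj ω) = C.conj (H.hodge ω) := by
  have h : C.conj.comp (H.hodge.comp C.conj) = H.hodge := by
    refine H.hodge_unique _ fun a b j h α hα => ?_
    have h' : b + a + j ≤ n := by omega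
    rw [LinearMap.comp_apply, LinearMap.comp_apply, H.conj_L_pow,
      H.hodge_L_pow h' (H.conj_mem_primitive hα), LinearMap.map_smulₛₗ, H.conj_L_pow, C.conj_conj,
      star_weilCoeff, add_comm b a]
  have h2 := congr_arg C.conj (LinearMap.congr_fun h ω)
  rwa [LinearMap.comp_apply, LinearMap.comp_apply, C.conj_conj] at h2

/-- Linear maps agreeing on the forms `L^j α`, for `α` primitive, are equal. -/
theorem linearMap_ext_of_L_pow {M : Type*} [AddCommMonoid M] [Module ℂ M] {T T' : C.Form →ₗ[ℂ] M}
    (hT : ∀ a b j, a + b + j ≤ n → ∀ α ∈ H.primitive a b, T ((H.L ^ j) α) = T' ((H.L ^ j) α)) :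
    T = T' := by
  have h : T ∘ₗ H.lefschetzMap = T' ∘ₗ H.lefschetzMap := by
    refine DirectSum.linearMap_ext ℂ fun i => LinearMap.ext fun α => ?_
    simp only [LinearMap.comp_apply, H.lefschetzMap_of]
    exact hT _ _ _ i.2 _ α.2
  ext ω
  obtain ⟨x, rfl⟩ := H.lefschetzMap_surjective ω
  exact LinearMap.congr_fun h x

/-- For α primitive of degree k, ∗ sends L^(n-j-k) α to a non-zero multiple of L^j α. Thus the range
contains all the generators of the Lefschetz decomposition. -/
theorem hodge_surjective : Function.Surjective H.hodge := by
  rw [← LinearMap.range_eq_top]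
  have : (LinearMap.range H.hodge).mkQ = 0 := by
    refine H.linearMap_ext_of_L_pow fun a b j h α hα => ?_
    rw [LinearMap.zero_apply, Submodule.mkQ_apply, Submodule.Quotient.mk_eq_zero]
    have h' : a + b + (n - j - (a + b)) ≤ n := by omega
    refine ⟨(weilCoeff n a b (n - j - (a + b)))⁻¹ • (H.L ^ (n - j - (a + b))) α, ?_⟩
    rw [map_smul, H.hodge_L_pow h' hα, inv_smul_smul₀ (weilCoeff_ne_zero _ _ _ _)]
    congr 2
    omega
  rw [← Submodule.ker_mkQ (LinearMap.range H.hodge), this, LinearMap.ker_zero]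

/-- The degree zero component of the Hodge dual of a form. -/
noncomputable def integral : C.Form →ₗ[ℂ] B := C.toBase ∘ₗ H.hodge

theorem integral_apply (ω : C.Form) : H.integral ω = C.toBase (H.hodge ω) := rfl

theorem integral_ι_mul (b : B) (ω : C.Form) : H.integral (C.ι b * ω) = b * H.integral ω := by
  rw [integral_apply, hodge_ι_mul, C.toBase_ι_mul, integral_apply]

theorem integral_mul_ι (ω : C.Form) (b : B) : H.integral (ω * C.ι b) = H.integral ω * b := by
  rw [integral_apply, hodge_mul_ι, C.toBase_mul_ι, integral_apply]

theorem integral_conj (ω : C.Form) : H.integral (C.conj ω) = star (H.integral ω) := by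
  rw [integral_apply, hodge_conj, H.toBase_conj, integral_apply]

theorem integral_of_deg_ne {k : ℕ} (hk : k ≠ 2 * n) {ω : C.Form} (hω : ω ∈ C.deg k) :
    H.integral ω = 0 := by
  rcases lt_or_gt_of_ne hk with h | h
  · exact C.toBase_of_ne (by omega) (H.hodge_mem_deg hω)
  · rw [H.totalDegree.eq_bot _ h, Submodule.mem_bot] at hω
    rw [hω, map_zero]

/-- The top degree is L^n(B), which lies in bidegree (n, n). -/
theorem integral_of_bideg_ne {p : ℕ × ℕ} (hp : p ≠ (n, n)) {ω : C.Form} (hω : ω ∈ H.bideg p) :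
    H.integral ω = 0 := by
  obtain ⟨a, b⟩ := p
  have hd := H.bideg_le _ _ hω
  by_cases hk : a + b = 2 * n
  · have hn : ω ∈ H.bideg (n, n) := by
      -- The Lefschetz isomorphism is available only for k < n; when n = 0 the pair is (0, 0) = (n,
      -- n) anyway.
      rcases Nat.eq_zero_or_pos n with rfl | h0
      · exact absurd (by simpa using hk) hp
      · rw [hk] at hd
        obtain ⟨η, hη, rfl⟩ := (H.lefschetz 0 h0).surjOn hd
        rw [SetLike.mem_coe, ← C.range_ι] at hη
        obtain ⟨b, rfl⟩ := hη
        exact H.L_pow_mem_bideg n (H.ι_mem_bideg b)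
    have h1 := DirectSum.decompose_of_mem_same H.bideg hω
    rw [DirectSum.decompose_of_mem_ne H.bideg hn hp.symm] at h1
    rw [← h1, map_zero]
  · exact H.integral_of_deg_ne hk hd

/-- Only products of degree 2n contribute. For k + l = 2n the sign (-1)^(kl) equals (-1)^k, so it
depends on ω alone and is carried by the grading involution. The identity then makes sense for
inhomogeneous forms. -/
theorem integral_conj_mul (ω ν : C.Form) :
    H.integral (C.conj (ω * ν)) = H.integral (C.conj ν * C.conj (C.gradeInvolution ω)) := by
  have := C.hom_ext_of_deg
    (S := H.integral.toAddMonoidHom.comp <| C.conj.toAddMonoidHom.comp (AddMonoidHom.mulRight ν))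
    (T := H.integral.toAddMonoidHom.comp <| (AddMonoidHom.mulLeft (C.conj ν)).comp <|
      C.conj.toAddMonoidHom.comp C.gradeInvolution.toAddMonoidHom)
    fun k ω hω => by
      have := C.hom_ext_of_deg
        (S := H.integral.toAddMonoidHom.comp <| C.conj.toAddMonoidHom.comp
          (AddMonoidHom.mulLeft ω))
        (T := H.integral.toAddMonoidHom.comp <|
          (AddMonoidHom.mulRight (C.conj (C.gradeInvolution ω))).comp C.conj.toAddMonoidHom)
        fun l ν hν => by
          change H.integral (C.conj (ω * ν)) = H.integral (C.conj ν * C.conj (C.gradeInvolution ω))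
          rw [C.gradeInvolution_of_mem hω, LinearMap.map_smulₛₗ, C.conj_mul k l _ hω _ hν,
            C.neg_one_pow_mul_eq_smul, map_pow, map_neg, map_one, mul_smul_comm, map_smul, map_smul]
          have hm := SetLike.mul_mem_graded (H.conj_mem_deg hν) (H.conj_mem_deg hω)
          by_cases hkl : l + k = 2 * n
          · congr 1
            -- With l = 2n - k one has kl = k² + 2k(n - k); the two cases avoid a negative
            -- difference in ℕ.
            have : k * l = k * k + 2 * (k * (n - k)) ∨ k * l + 2 * (k * (k - n)) = k * k := by
              rcases le_total k n with h | h
              · left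
                obtain ⟨c, rfl⟩ := Nat.exists_eq_add_of_le h
                obtain rfl : l = k + 2 * c := by omega
                simp only [Nat.add_sub_cancel_left]; ring
              · right
                obtain ⟨c, rfl⟩ := Nat.exists_eq_add_of_le h
                obtain rfl : n = l + c := by omega
                simp only [Nat.add_sub_cancel_left]; ring
            have hp : Even (k * l) ↔ Even k := by
              rcases this with h | h
              · rw [h]; simp [Nat.even_add, Nat.even_mul]
              · have h2 : Even (k * l + 2 * (k * (k - n))) ↔ Even k := by
                  rw [h]; simp [Nat.even_mul]
                simpa [Nat.even_add, Nat.even_mul] using h2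
            by_cases he : Even k
            · rw [he.neg_one_pow, (hp.2 he).neg_one_pow]
            · rw [(Nat.not_even_iff_odd.1 he).neg_one_pow,
                (Nat.not_even_iff_odd.1 (mt hp.1 he)).neg_one_pow]
          · rw [H.integral_of_deg_ne hkl hm, smul_zero, smul_zero]
      exact DFunLike.congr_fun this ν
  exact DFunLike.congr_fun this ω

theorem L_pow_mul_L_pow (M N : ℕ) (ω ν : C.Form) :
    (H.L ^ M) ω * (H.L ^ N) ν = (H.L ^ (M + N)) (ω * ν) := by
  have hc : ∀ ω, Commute (H.σ ^ N) ω := fun ω => Commute.pow_left (H.σ_central ω) N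
  rw [L_pow_apply, L_pow_apply, L_pow_apply, mul_assoc, ← mul_assoc ω, ← (hc ω).eq, pow_add]
  simp only [mul_assoc]

/-- The two equations force (c, d) = (b, a), and i^(b-a) = (-1)^(a+b) i^(a-b). -/
theorem weilCoeff_swap {a b c d : ℕ} (hac : a + c = b + d) (hk : a + b = c + d) (n j : ℕ) :
    weilCoeff n c d j = (-1) ^ (a + b) * weilCoeff n a b j := by
  obtain rfl : c = b := by omega
  obtain rfl : d = a := by omega
  simp only [weilCoeff]
  have : (Complex.I : ℂ) ^ ((c : ℤ) - d) = (-1) ^ (d + c) * Complex.I ^ ((d : ℤ) - c) := by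
    have h1 : ((-1 : ℂ)) ^ (d + c) = Complex.I ^ (2 * ((d + c : ℕ) : ℤ)) := by
      rw [zpow_mul, zpow_natCast]; norm_num
    rw [h1, ← zpow_add₀ Complex.I_ne_zero]
    have h2 : (2 * ((d + c : ℕ) : ℤ) + (d - c)) = (c - d) + 4 * d := by push_cast; ring
    have h4 : (Complex.I : ℂ) ^ (4 : ℤ) = 1 := by
      have := Complex.I_pow_four
      exact_mod_cast this
    rw [h2, zpow_add₀ Complex.I_ne_zero, zpow_mul, h4, one_zpow, mul_one]
  rw [this, add_comm c d]
  ring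

/-- Both sides are multiples of ∫ L^N(α ∧ β), which vanishes unless the bidegree is (n, n). When L^i
α and L^j β have equal degree and i ≠ j, the exponent N is too large for the primitive factor of
larger degree. When i = j, the surviving case is (c, d) = (b, a), and the Weil coefficients differ
by the sign (-1)^(a+b). -/
theorem integral_mul_hodge_L_pow {a b i c d j : ℕ} (hi : a + b + i ≤ n) (hj : c + d + j ≤ n)
    {α β : C.Form} (hα : α ∈ H.primitive a b) (hβ : β ∈ H.primitive c d) :
    H.integral ((H.L ^ i) α * H.hodge ((H.L ^ j) β)) =
      (-1 : ℂ) ^ (a + b) • H.integral (H.hodge ((H.L ^ i) α) * (H.L ^ j) β) := by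
  rw [H.hodge_L_pow hi hα, H.hodge_L_pow hj hβ, mul_smul_comm, smul_mul_assoc, L_pow_mul_L_pow,
    L_pow_mul_L_pow, map_smul, map_smul, smul_smul]
  have hm : α * β ∈ H.bideg (a + c, b + d) := SetLike.mul_mem_graded hα.1 hβ.1
  have hx := H.L_pow_mem_bideg (i + (n - j - (c + d))) hm
  have hy := H.L_pow_mem_bideg (n - i - (a + b) + j) hm
  have hzl : ∀ N, n + 1 ≤ N + (a + b) → (H.L ^ N) (α * β) = 0 := fun N hN => by
    have := H.L_pow_mul_L_pow N 0 α β
    rw [H.L_pow_eq_zero hα hN, zero_mul] at this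
    exact this.symm
  have hzr : ∀ N, n + 1 ≤ N + (c + d) → (H.L ^ N) (α * β) = 0 := fun N hN => by
    have := H.L_pow_mul_L_pow 0 N α β
    rw [H.L_pow_eq_zero hβ hN, mul_zero, zero_add] at this
    exact this.symm
  by_cases hdeg : 2 * i + (a + b) = 2 * j + (c + d)
  · rcases lt_trichotomy i j with hij | rfl | hij
    -- Here both exponents are n - (a + b) + (j - i), beyond the bound at which L kills α.
    · rw [hzl _ (by omega), hzl _ (by omega), map_zero, smul_zero, smul_zero]
    · have e : n - i - (a + b) + i = i + (n - i - (c + d)) := by omega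
      rw [e]
      by_cases hac : a + c = b + d
      · rw [weilCoeff_swap hac (by omega)]
      · rw [H.integral_of_bideg_ne (fun h => hac ?_) hx, smul_zero, smul_zero]
        simp only [Prod.mk.injEq] at h
        omega
    · rw [hzr _ (by omega), hzr _ (by omega), map_zero, smul_zero, smul_zero]
  · rw [H.integral_of_bideg_ne (fun h => hdeg ?_) hx, H.integral_of_bideg_ne (fun h => hdeg ?_) hy,
      smul_zero, smul_zero] <;>
    · simp only [Prod.mk.injEq] at h
      omega

theorem integral_mul_hodge (ω ν : C.Form) :
    H.integral (ω * H.hodge ν) = H.integral (H.hodge (C.gradeInvolution ω) * ν) := by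
  have h1 : H.integral ∘ₗ LinearMap.mulRight ℂ (H.hodge ν) =
      H.integral ∘ₗ LinearMap.mulRight ℂ ν ∘ₗ H.hodge ∘ₗ C.gradeInvolution := by
    refine H.linearMap_ext_of_L_pow fun a b i hi α hα => ?_
    have h2 : H.integral ∘ₗ LinearMap.mulLeft ℂ ((H.L ^ i) α) ∘ₗ H.hodge =
        (-1 : ℂ) ^ (a + b) • H.integral ∘ₗ LinearMap.mulLeft ℂ (H.hodge ((H.L ^ i) α)) :=
      H.linearMap_ext_of_L_pow fun c d j hj β hβ => H.integral_mul_hodge_L_pow hi hj hα hβ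
    have h3 := C.gradeInvolution_of_mem (H.L_pow_mem_deg i (H.bideg_le _ _ hα.1))
    have h4 : (-1 : ℂ) ^ (2 * i + (a + b)) = (-1) ^ (a + b) := by
      rw [pow_add, pow_mul]; simp
    refine (LinearMap.congr_fun h2 ν).trans ?_
    simp only [LinearMap.comp_apply, LinearMap.smul_apply, LinearMap.mulLeft_apply,
      LinearMap.mulRight_apply, h3, h4, map_smul]
  exact LinearMap.congr_fun h1 ω

theorem metric_eq_integral (ω ν : C.Form) :
    H.metric ω ν = H.integral (ω * H.hodge (C.conj ν)) := rfl

/-- Forms of different degrees are orthogonal, and in equal degrees the two signs cancel. -/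
theorem metric_gradeInvolution (ω ν : C.Form) :
    H.metric (C.gradeInvolution ω) (C.gradeInvolution ν) = H.metric ω ν := by
  have h1 := C.hom_ext_of_deg
    (S := (H.integral ∘ₗ LinearMap.mulRight ℂ (H.hodge (C.conj (C.gradeInvolution ν))) ∘ₗ
      C.gradeInvolution).toAddMonoidHom)
    (T := (H.integral ∘ₗ LinearMap.mulRight ℂ (H.hodge (C.conj ν))).toAddMonoidHom)
    fun k ω hω => by
      have h2 := C.hom_ext_of_deg
        (S := H.integral.toAddMonoidHom.comp <| (AddMonoidHom.mulLeft (C.gradeInvolution ω)).comp <|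
          H.hodge.toAddMonoidHom.comp <| C.conj.toAddMonoidHom.comp
            C.gradeInvolution.toAddMonoidHom)
        (T := H.integral.toAddMonoidHom.comp <| (AddMonoidHom.mulLeft ω).comp <|
          H.hodge.toAddMonoidHom.comp C.conj.toAddMonoidHom)
        fun l ν hν => by
          change H.metric (C.gradeInvolution ω) (C.gradeInvolution ν) = H.metric ω ν
          by_cases hkl : k = l
          · subst hkl
            rw [C.gradeInvolution_of_mem hω, C.gradeInvolution_of_mem hν, metric_eq_integral,
              metric_eq_integral, LinearMap.map_smulₛₗ, map_smul, smul_mul_smul_comm, map_smul,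
              map_pow, map_neg, map_one, ← mul_pow]
            simp
          · rw [H.metric_of_ne hkl hω hν]
            refine H.metric_of_ne hkl ?_ ?_
            · rw [C.gradeInvolution_of_mem hω]
              exact Submodule.smul_mem _ _ hω
            · rw [C.gradeInvolution_of_mem hν]
              exact Submodule.smul_mem _ _ hν
      exact DFunLike.congr_fun h2 ν
  exact DFunLike.congr_fun h1 ω

/-- Conjugating ∫ ν ∧ ∗(ω*) gives ∫ ∗ω ∧ (γν)*, with γ the grading involution. Moving ∗ to the other
factor gives g(γω, γν), which is g(ω, ν). -/
theorem metric_conj_symm (ω ν : C.Form) : H.metric ω ν = star (H.metric ν ω) := by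
  rw [metric_eq_integral H ν, ← integral_conj, integral_conj_mul, ← hodge_conj, C.conj_conj,
    ← C.gradeInvolution_gradeInvolution ω, ← integral_mul_hodge, C.gradeInvolution_gradeInvolution,
    ← metric_eq_integral, metric_gradeInvolution]

theorem metric_add_left (ω ω' ν : C.Form) :
    H.metric (ω + ω') ν = H.metric ω ν + H.metric ω' ν := by
  simp only [metric_eq_integral, add_mul, map_add]

theorem metric_add_right (ω ν ν' : C.Form) :
    H.metric ω (ν + ν') = H.metric ω ν + H.metric ω ν' := by
  simp only [metric_eq_integral, mul_add, map_add]

theorem metric_smul_left (b : B) (ω ν : C.Form) : H.metric (b • ω) ν = b * H.metric ω ν := by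
  rw [C.smul_def, metric_eq_integral, mul_assoc, integral_ι_mul, metric_eq_integral]

theorem metric_smul_right (b : B) (ω ν : C.Form) :
    H.metric ω (b • ν) = H.metric ω ν * star b := by
  rw [C.smul_def, metric_eq_integral, C.conj_ι_mul, hodge_mul_ι, ← mul_assoc, integral_mul_ι,
    metric_eq_integral]

/-- Every conjugate functional `ω ↦ (∫ ν ω^*)^*` is given by the metric. -/
theorem exists_star_integral_eq_metric (ν : C.Form) :
    ∃ η : C.Form, ∀ ω, star (H.integral (ν * C.conj ω)) = H.metric ω η := by
  -- Reversing the product turns the left side into ∫ ω ∧ (γν)*, so η must satisfy ∗(η*) = (γν)*.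
  obtain ⟨ξ, hξ⟩ := H.hodge_surjective (C.conj (C.gradeInvolution ν))
  refine ⟨C.conj ξ, fun ω => ?_⟩
  rw [metric_eq_integral, C.conj_conj, hξ, ← integral_conj, integral_conj_mul, C.conj_conj]

end HermitianStructure

end FormalHodgeTheory

/-! ### Slices of coactions and antipode identities -/

section Comodules

open TensorProduct Coalgebra

variable {A : Type u} [Ring A] [HopfAlgebra ℂ A]
variable {F : Type u} [AddCommGroup F] [Module ℂ F]

/-- The contraction of a tensor `a ⊗ f` with a functional on the first factor. -/
noncomputable def slice (l : A →ₗ[ℂ] ℂ) : A ⊗[ℂ] F →ₗ[ℂ] F :=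
  (TensorProduct.lid ℂ F).toLinearMap ∘ₗ LinearMap.rTensor F l

@[simp] theorem slice_tmul (l : A →ₗ[ℂ] ℂ) (a : A) (f : F) : slice l (a ⊗ₜ[ℂ] f) = l a • f := by
  simp [slice]

/-- Slices turn comodule statements into statements about ordinary linear operators ω ↦ l(ω₍₋₁₎)
ω₍₀₎, to which `hodge_comm` can be applied. -/
theorem slice_lTensor {G : Type u} [AddCommGroup G] [Module ℂ G] (l : A →ₗ[ℂ] ℂ)
    (T : F →ₗ[ℂ] G) (z : A ⊗[ℂ] F) : slice l (LinearMap.lTensor A T z) = T (slice l z) := by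
  induction z with
  | zero => simp
  | tmul a f => simp
  | add x y hx hy => rw [map_add, map_add, map_add, map_add, hx, hy]

theorem apply_rid_lTensor (l : A →ₗ[ℂ] ℂ) (e : F →ₗ[ℂ] ℂ) (z : A ⊗[ℂ] F) :
    l (TensorProduct.rid ℂ A (LinearMap.lTensor A e z)) = e (slice l z) := by
  induction z with
  | zero => simp
  | tmul a f => simp [mul_comm]
  | add x y hx hy => simp only [map_add, hx, hy]

/-- The map `a ⊗ a' ⊗ f ↦ P(a ⊗ a') ⊗ f`. -/
noncomputable def contract (F : Type u) [AddCommGroup F] [Module ℂ F] (P : A ⊗[ℂ] A →ₗ[ℂ] A) :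
    A ⊗[ℂ] (A ⊗[ℂ] F) →ₗ[ℂ] A ⊗[ℂ] F :=
  LinearMap.rTensor F P ∘ₗ (TensorProduct.assoc ℂ A A F).symm.toLinearMap

@[simp] theorem contract_tmul (P : A ⊗[ℂ] A →ₗ[ℂ] A) (a a' : A) (f : F) :
    contract F P (a ⊗ₜ (a' ⊗ₜ f)) = P (a ⊗ₜ a') ⊗ₜ f := by
  simp [contract]

theorem contract_rTensor_antipode (P : A ⊗[ℂ] A →ₗ[ℂ] A) (δ : F →ₗ[ℂ] A ⊗[ℂ] F) (z : A ⊗[ℂ] F) :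
    contract F P (LinearMap.lTensor A δ (LinearMap.rTensor F (HopfAlgebra.antipode ℂ) z)) =
      contract F (P ∘ₗ LinearMap.rTensor A (HopfAlgebra.antipode ℂ)) (LinearMap.lTensor A δ z) := by
  induction z with
  | zero => simp
  | add x y hx hy => simp only [map_add, hx, hy]
  | tmul a f =>
    simp only [LinearMap.rTensor_tmul, LinearMap.lTensor_tmul]
    induction δ f with
    | zero => simp
    | add x y hx hy => simp only [tmul_add, map_add, hx, hy]
    | tmul a' f' => simp

variable {δ : F →ₗ[ℂ] A ⊗[ℂ] F}

namespace IsLeftCoaction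

theorem contract_apply (hδ : IsLeftCoaction δ) (P : A ⊗[ℂ] A →ₗ[ℂ] A) (f : F) :
    contract F P (LinearMap.lTensor A δ (δ f)) = LinearMap.rTensor F (P ∘ₗ comul) (δ f) := by
  rw [← hδ.coassoc, contract, LinearMap.comp_apply, LinearEquiv.coe_coe,
    LinearEquiv.symm_apply_apply, LinearMap.rTensor_comp, LinearMap.comp_apply]

theorem rTensor_algebraMap_counit (hδ : IsLeftCoaction δ) (f : F) :
    LinearMap.rTensor F (Algebra.linearMap ℂ A ∘ₗ Coalgebra.counit) (δ f) = 1 ⊗ₜ f := by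
  conv_rhs => rw [← hδ.counit f]
  induction δ f with
  | zero => simp
  | add x y hx hy => simp only [tmul_add, map_add, hx, hy]
  | tmul a' f' => simp [Algebra.algebraMap_eq_smul_one, smul_tmul]

/-- `S(f₍₋₂₎) f₍₋₁₎ ⊗ f₍₀₎ = 1 ⊗ f`. -/
theorem antipode_mul_cancel (hδ : IsLeftCoaction δ) (f : F) :
    contract F (LinearMap.mul' ℂ A)
      (LinearMap.lTensor A δ (LinearMap.rTensor F (HopfAlgebra.antipode ℂ) (δ f))) = 1 ⊗ₜ f := by
  rw [contract_rTensor_antipode, hδ.contract_apply, LinearMap.comp_assoc,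
    HopfAlgebra.mul_antipode_rTensor_comul, hδ.rTensor_algebraMap_counit]

/-- `f₍₋₂₎ S(f₍₋₁₎) ⊗ f₍₀₎ = 1 ⊗ f`. -/
theorem mul_antipode_cancel (hδ : IsLeftCoaction δ) (f : F) :
    contract F (LinearMap.mul' ℂ A) (LinearMap.lTensor A
      (LinearMap.rTensor F (HopfAlgebra.antipode ℂ) ∘ₗ δ) (δ f)) = 1 ⊗ₜ f := by
  have h : ∀ z : A ⊗[ℂ] F, contract F (LinearMap.mul' ℂ A) (LinearMap.lTensor A
      (LinearMap.rTensor F (HopfAlgebra.antipode ℂ) ∘ₗ δ) z) =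
      contract F (LinearMap.mul' ℂ A ∘ₗ LinearMap.lTensor A (HopfAlgebra.antipode ℂ))
        (LinearMap.lTensor A δ z) := fun z => by
    induction z with
    | zero => simp
    | add x y hx hy => simp only [map_add, hx, hy]
    | tmul a f =>
      simp only [LinearMap.lTensor_tmul, LinearMap.comp_apply]
      induction δ f with
      | zero => simp
      | add x y hx hy => simp only [tmul_add, map_add, hx, hy]
      | tmul a' f' => simp
  rw [h, hδ.contract_apply, LinearMap.comp_assoc,
    HopfAlgebra.mul_antipode_lTensor_comul, hδ.rTensor_algebraMap_counit]

end IsLeftCoaction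

theorem isLeftCoaction_comul : IsLeftCoaction (comul (R := ℂ) (A := A)) where
  coassoc := Coalgebra.coassoc_apply
  counit a := by rw [Coalgebra.rTensor_counit_comul]; simp

/-- `S(a₍₁₎) a₍₂₎ b S(a₍₃₎) = b S(a)`. -/
theorem antipode_mul_adjointMap (b a : A) :
    LinearMap.mul' ℂ A (TensorProduct.map (HopfAlgebra.antipode ℂ) (adjointMap b) (comul a)) =
      b * HopfAlgebra.antipode ℂ a := by
  have h : ∀ z : A ⊗[ℂ] A,
      LinearMap.mul' ℂ A (TensorProduct.map (HopfAlgebra.antipode ℂ) (adjointMap b) z) =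
        LinearMap.mul' ℂ A (TensorProduct.map (LinearMap.mulRight ℂ b) (HopfAlgebra.antipode ℂ)
          (contract A (LinearMap.mul' ℂ A) (LinearMap.lTensor A comul
            (LinearMap.rTensor A (HopfAlgebra.antipode ℂ) z)))) := fun z => by
    induction z with
    | zero => simp
    | add x y hx hy => simp only [map_add, hx, hy]
    | tmul a a' =>
      simp only [LinearMap.lTensor_tmul, LinearMap.rTensor_tmul, TensorProduct.map_tmul,
        LinearMap.mul'_apply, adjointMap, LinearMap.comp_apply]
      induction comul (R := ℂ) a' with
      | zero => simp
      | add x y hx hy => simp only [tmul_add, map_add, mul_add, hx, hy]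
      | tmul u v => simp [mul_assoc]
  rw [h, isLeftCoaction_comul.antipode_mul_cancel]
  simp

/-- This is what makes the right action of `B` on the fibre go through ε. -/
theorem counit_adjointMap (b a : A) :
    counit (R := ℂ) (adjointMap b a) = counit (R := ℂ) b * counit (R := ℂ) a := by
  have h : ∀ z : A ⊗[ℂ] A, counit (R := ℂ) (LinearMap.mul' ℂ A
      (TensorProduct.map (LinearMap.mulRight ℂ b) (HopfAlgebra.antipode ℂ) z)) =
      counit (R := ℂ) b * counit (R := ℂ)
        (TensorProduct.lid ℂ A (LinearMap.rTensor A counit z)) := fun z => by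
    induction z with
    | zero => simp
    | add x y hx hy => simp only [map_add, mul_add, hx, hy]
    | tmul u v =>
      simp
      ring
  rw [adjointMap, LinearMap.comp_apply, LinearMap.comp_apply, h, isLeftCoaction_comul.counit]

end Comodules

/-! ### The integral as a comodule map -/

section CovariantIntegral

open TensorProduct Coalgebra

variable {A : Type u} [Ring A] [HopfAlgebra ℂ A] [StarRing A] [StarModule ℂ A]
variable {B : StarSubalgebra ℂ A}

/-- A map `I : Ω^• → B` of `B`-bimodules and left `A`-comodules; the latter is expressed by
`I(ω) = ω₍₋₁₎ ε(I(ω₍₀₎))`. -/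
structure IsInvariantIntegral (C : DifferentialCalculus B) (δ : C.Form →ₐ[ℂ] A ⊗[ℂ] C.Form)
    (I : C.Form →ₗ[ℂ] B) : Prop where
  ι_mul : ∀ b ω, I (C.ι b * ω) = b * I ω
  mul_ι : ∀ ω b, I (ω * C.ι b) = I ω * b
  invariant : ∀ ω, (I ω : A) =
    TensorProduct.rid ℂ A (LinearMap.lTensor A (counit ∘ₗ incl B ∘ₗ I) (δ ω))

/-- Coinvariance of σ makes every slice of the coaction commute with L, and covariance of the
bigrading makes it bigraded. Hence slices commute with ∗, and only the degree zero part, where the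
coaction is Δ, has to be examined. -/
theorem HermitianStructure.IsCovariant.isInvariantIntegral {C : StarCalculus B} {n : ℕ}
    {H : HermitianStructure C n} {δ : C.Form →ₐ[ℂ] A ⊗[ℂ] C.Form}
    (hcov : H.IsCovariant δ) (hC : C.IsCovariant δ) :
    IsInvariantIntegral C.toDifferentialCalculus δ H.integral where
  ι_mul := H.integral_ι_mul
  mul_ι := H.integral_mul_ι
  invariant ω := by
    -- An identity in `A` may be tested against all linear functionals l.
    rw [← sub_eq_zero, ← Module.forall_dual_apply_eq_zero_iff ℂ]
    intro l
    rw [map_sub, sub_eq_zero, apply_rid_lTensor]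
    have hσ : ∀ ω, slice l (δ (H.σ * ω)) = H.σ * slice l (δ ω) := fun ω => by
      have h : ∀ z : A ⊗[ℂ] C.Form,
          ((1 : A) ⊗ₜ[ℂ] H.σ) * z = LinearMap.lTensor A (LinearMap.mulLeft ℂ H.σ) z := fun z => by
        induction z with
        | zero => simp
        | add x y hx hy => rw [mul_add, map_add, hx, hy]
        | tmul a f => simp
      rw [map_mul, hcov.σ_coinvariant, h, slice_lTensor, LinearMap.mulLeft_apply]
    have hb : ∀ p, ∀ ω ∈ H.bideg p, slice l (δ ω) ∈ H.bideg p := fun p ω hω => by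
      obtain ⟨z, hz⟩ := hcov.bideg_coaction p ω hω
      rw [← hz, slice_lTensor]
      exact SetLike.coe_mem _
    have hdeg : ∀ k, ∀ ω ∈ C.deg k, slice l (δ ω) ∈ C.deg k := fun k => by
      have : C.deg k ≤ (C.deg k).comap (slice l ∘ₗ δ.toLinearMap) := by
        refine (H.deg_eq k).le.trans (iSup₂_le fun p hp ω hω => ?_)
        rw [← hp]
        exact H.bideg_le _ _ (hb p ω hω)
      exact this
    have hh := H.hodge_comm (T := slice l ∘ₗ δ.toLinearMap) hσ hb ω
    simp only [LinearMap.comp_apply, AlgHom.toLinearMap_apply, H.integral_apply] at hh ⊢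
    rw [hh]
    generalize H.hodge ω = η
    have := C.hom_ext_of_deg
      (S := (l ∘ₗ incl B ∘ₗ C.toBase).toAddMonoidHom)
      (T := (counit ∘ₗ incl B ∘ₗ C.toBase ∘ₗ slice l ∘ₗ δ.toLinearMap).toAddMonoidHom)
      fun k η hη => by
        change l (incl B (C.toBase η)) = counit (incl B (C.toBase (slice l (δ η))))
        rcases eq_or_ne k 0 with rfl | hk
        · rw [← C.range_ι] at hη
          obtain ⟨b, rfl⟩ := hη
          obtain ⟨t, ht, hδ⟩ := hC.extends_comul b
          rw [AlgHom.toLinearMap_apply, C.toBase_ι, hδ, slice_lTensor, AlgHom.toLinearMap_apply,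
            C.toBase_ι, ← slice_lTensor, ht, ← apply_rid_lTensor, Coalgebra.lTensor_counit_comul]
          simp [incl]
        · rw [C.toBase_of_ne hk hη, C.toBase_of_ne hk (hdeg _ _ hη)]
          simp
    exact DFunLike.congr_fun this η

variable {C : DifferentialCalculus B} {δ : C.Form →ₐ[ℂ] A ⊗[ℂ] C.Form} {I : C.Form →ₗ[ℂ] B}

theorem contract_mul_tmul (a : A) (z : A ⊗[ℂ] C.Form) :
    contract C.Form (LinearMap.mul' ℂ A) (a ⊗ₜ z) = (a ⊗ₜ[ℂ] (1 : C.Form)) * z := by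
  induction z with
  | zero => simp
  | add x y hx hy => rw [tmul_add, mul_add, map_add, hx, hy]
  | tmul a f => simp

theorem mul_rid_lTensor (a : A) (e : C.Form →ₗ[ℂ] ℂ) (z : A ⊗[ℂ] C.Form) :
    a * TensorProduct.rid ℂ A (LinearMap.lTensor A e z) =
      TensorProduct.rid ℂ A (LinearMap.lTensor A e ((a ⊗ₜ[ℂ] (1 : C.Form)) * z)) := by
  induction z with
  | zero => simp
  | add x y hx hy => simp only [mul_add, map_add, hx, hy]
  | tmul a f => simp

/-- `S(x₍₋₁₎) I(x₍₀₎ w) = w₍₋₁₎ ε(I(x w₍₀₎))`. -/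
theorem IsInvariantIntegral.antipode_mul (hI : IsInvariantIntegral C δ I)
    (hδ : IsLeftCoaction δ.toLinearMap) (x w : C.Form) :
    LinearMap.mul' ℂ A (TensorProduct.map (HopfAlgebra.antipode ℂ)
      (incl B ∘ₗ I ∘ₗ LinearMap.mulRight ℂ w) (δ x)) =
    TensorProduct.rid ℂ A (LinearMap.lTensor A
      (counit ∘ₗ incl B ∘ₗ I ∘ₗ LinearMap.mulLeft ℂ x) (δ w)) := by
  have h : ∀ z : A ⊗[ℂ] C.Form, LinearMap.mul' ℂ A (TensorProduct.map (HopfAlgebra.antipode ℂ)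
      (incl B ∘ₗ I ∘ₗ LinearMap.mulRight ℂ w) z) =
      TensorProduct.rid ℂ A (LinearMap.lTensor A (counit ∘ₗ incl B ∘ₗ I)
        (contract C.Form (LinearMap.mul' ℂ A) (LinearMap.lTensor A δ.toLinearMap
          (LinearMap.rTensor C.Form (HopfAlgebra.antipode ℂ) z)) * δ w)) := fun z => by
    induction z with
    | zero => simp
    | add x y hx hy => simp only [map_add, add_mul, hx, hy]
    | tmul a f =>
      simp only [LinearMap.lTensor_tmul, LinearMap.rTensor_tmul, TensorProduct.map_tmul,
        LinearMap.mul'_apply, LinearMap.comp_apply, contract_mul_tmul, LinearMap.mulRight_apply,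
        AlgHom.toLinearMap_apply]
      have := hI.invariant (f * w)
      change _ * ((I (f * w) : B) : A) = _
      rw [this, mul_rid_lTensor, map_mul δ, mul_assoc]
  have h2 : ∀ z : A ⊗[ℂ] C.Form,
      ((1 : A) ⊗ₜ[ℂ] x) * z = LinearMap.lTensor A (LinearMap.mulLeft ℂ x) z := fun z => by
    induction z with
    | zero => simp
    | add x y hx hy => rw [mul_add, map_add, hx, hy]
    | tmul a f => simp
  rw [h]
  have := hδ.antipode_mul_cancel x
  rw [AlgHom.toLinearMap_apply] at this
  rw [this, h2, ← LinearMap.comp_apply (LinearMap.lTensor A _), ← LinearMap.lTensor_comp]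
  rfl

end CovariantIntegral

/-! ### Consequences of faithful flatness for A ⊗_B - -/

section FaithfullyFlatDescent

open TensorProduct Coalgebra

variable {A : Type u} [Ring A] [HopfAlgebra ℂ A] [StarRing A] [StarModule ℂ A]
variable {B : StarSubalgebra ℂ A}
variable {M N : Type u} [AddCommGroup M] [Module ℂ M] [Module B M] [IsScalarTower ℂ B M]
  [AddCommGroup N] [Module ℂ N] [Module B N] [IsScalarTower ℂ B N]

theorem balancedMk_mul_tmul (a : A) (b : B) (m : M) :
    (balancedRel B M).mkQ ((a * (b : A)) ⊗ₜ m) = (balancedRel B M).mkQ (a ⊗ₜ (b • m)) :=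
  (Submodule.Quotient.eq _).2 (Submodule.subset_span ⟨a, b, m, rfl⟩)

theorem balancedMap_mk (f : M →ₗ[B] N) (z : A ⊗[ℂ] M) :
    balancedMap B f ((balancedRel B M).mkQ z) =
      (balancedRel B N).mkQ (LinearMap.lTensor A (f.restrictScalars ℂ) z) := rfl

variable (B M) in
/-- Left multiplication by `a` on `A ⊗_B M`. -/
noncomputable def balancedMulLeft (a : A) : BalancedTensor B M →ₗ[ℂ] BalancedTensor B M :=
  Submodule.mapQ _ _ (LinearMap.rTensor M (LinearMap.mulLeft ℂ a)) <| by
    refine Submodule.span_le.2 ?_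
    rintro x ⟨a', b, m, rfl⟩
    refine Submodule.subset_span ⟨a * a', b, m, ?_⟩
    simp [mul_assoc]

theorem balancedMulLeft_mk (a : A) (z : A ⊗[ℂ] M) :
    balancedMulLeft B M a ((balancedRel B M).mkQ z) =
      (balancedRel B M).mkQ (LinearMap.rTensor M (LinearMap.mulLeft ℂ a) z) := rfl

/-- A tensor with values in a finite power is the sum of its reinserted coordinates, and reinsertion
is `B`-linear, hence defined on A ⊗_B. -/
theorem balancedMk_pi_ext {m : ℕ} {z z' : A ⊗[ℂ] (Fin m → M)}
    (h : ∀ i, (balancedRel B M).mkQ (LinearMap.lTensor A (LinearMap.proj i) z) =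
      (balancedRel B M).mkQ (LinearMap.lTensor A (LinearMap.proj i) z')) :
    (balancedRel B (Fin m → M)).mkQ z = (balancedRel B (Fin m → M)).mkQ z' := by
  have key : ∀ z : A ⊗[ℂ] (Fin m → M), (balancedRel B (Fin m → M)).mkQ z =
      ∑ i, balancedMap B (LinearMap.single B (fun _ => M) i)
        ((balancedRel B M).mkQ (LinearMap.lTensor A (LinearMap.proj i) z)) := fun z => by
    simp only [balancedMap_mk, ← map_sum]
    congr 1
    induction z with
    | zero => simp
    | add x y hx hy =>
      simp only [map_add, Finset.sum_add_distrib]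
      rw [← hx, ← hy]
    | tmul a f =>
      simp only [LinearMap.lTensor_tmul, ← tmul_sum]
      congr 1
      exact (Finset.univ_sum_single f).symm
  rw [key, key]
  simp only [h]

theorem IsFaithfullyFlatRight.balancedMap_injective (hff : IsFaithfullyFlatRight B)
    {f : M →ₗ[B] N} (hf : Function.Injective f) : Function.Injective (balancedMap B f) := by
  have h : Function.Exact (0 : PUnit.{u + 1} →ₗ[B] M) f := fun x => by
    constructor
    · intro hx
      exact ⟨0, (hf (hx.trans (map_zero f).symm)).symm⟩
    · rintro ⟨y, rfl⟩
      simp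
  have h2 := (hff _ _ _ _ _).1 h
  rw [injective_iff_map_eq_zero]
  intro x hx
  obtain ⟨y, rfl⟩ := (h2 x).1 hx
  obtain ⟨y, rfl⟩ := Submodule.mkQ_surjective _ y
  rw [balancedMap_mk]
  have : (0 : PUnit.{u + 1} →ₗ[B] M).restrictScalars ℂ = 0 := rfl
  rw [this, LinearMap.lTensor_zero]
  simp

/-- The sequence B → M → M given by 1 ↦ x and the identity becomes exact over A ⊗_B, because the
first map becomes zero. Reflecting exactness forces the range of the first map to be zero. -/
theorem IsFaithfullyFlatRight.eq_zero_of_balancedMk (hff : IsFaithfullyFlatRight B) {x : M}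
    (hx : (balancedRel B M).mkQ (1 ⊗ₜ x) = 0) : x = 0 := by
  have h0 : ∀ z, balancedMap B (LinearMap.toSpanSingleton B M x) ((balancedRel B B).mkQ z) = 0 := by
    intro z
    rw [balancedMap_mk]
    induction z with
    | zero => simp
    | add x y hx hy => rw [map_add, map_add, hx, hy, add_zero]
    | tmul a b =>
      have h1 := balancedMulLeft_mk (B := B) (M := M) (a * (b : A)) (1 ⊗ₜ x)
      rw [hx, map_zero, LinearMap.rTensor_tmul, LinearMap.mulLeft_apply, mul_one,
        balancedMk_mul_tmul] at h1
      exact h1.symm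
  have h : Function.Exact (balancedMap B (LinearMap.toSpanSingleton B M x))
      (balancedMap B (LinearMap.id : M →ₗ[B] M)) := fun y => by
    have hid : balancedMap B (LinearMap.id : M →ₗ[B] M) y = y := by
      obtain ⟨z, rfl⟩ := Submodule.mkQ_surjective _ y
      rw [balancedMap_mk]
      congr 1
      exact LinearMap.congr_fun (LinearMap.lTensor_id A M) z
    rw [hid]
    constructor
    · rintro rfl
      exact ⟨0, map_zero _⟩
    · rintro ⟨z, rfl⟩
      obtain ⟨z, rfl⟩ := Submodule.mkQ_surjective _ z
      exact h0 z
  have h2 := (hff _ _ _ _ _).2 h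
  have h3 := (h2 x).2 ⟨1, by simp⟩
  exact h3

/-- Exactness of A ⊗_B - on P → M → M/P shows that 1 ⊗ x dies in A ⊗_B (M/P); the previous criterion
applies to the class of x. -/
theorem IsFaithfullyFlatRight.mem_of_balancedMk (hff : IsFaithfullyFlatRight B)
    {P : Submodule B M} {x : M}
    (hx : (balancedRel B M).mkQ (1 ⊗ₜ x) ∈ LinearMap.range (balancedMap B P.subtype)) : x ∈ P := by
  rw [← Submodule.Quotient.mk_eq_zero]
  refine hff.eq_zero_of_balancedMk ?_
  have h := (hff _ _ _ _ _).1 (LinearMap.exact_subtype_mkQ P)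
  exact (h _).2 hx

end FaithfullyFlatDescent

/-! ### The fibre Ω/B⁺Ω -/

section Fibre

open TensorProduct Coalgebra

variable {A : Type u} [Ring A] [HopfAlgebra ℂ A] [StarRing A] [StarModule ℂ A]
variable {B : StarSubalgebra ℂ A}

/-- The subspace `B⁺ Ω^•`, spanned by the forms `b ω - ε(b) ω`. -/
def augmentationForms (C : DifferentialCalculus B) : Submodule ℂ C.Form :=
  Submodule.span ℂ {x | ∃ (b : B) (ω : C.Form), x = C.ι b * ω - counit (R := ℂ) (b : A) • ω}

variable {C : DifferentialCalculus B} {δ : C.Form →ₐ[ℂ] A ⊗[ℂ] C.Form} {I : C.Form →ₗ[ℂ] B}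

theorem augmentationForms_le_ker {M : Type*} [AddCommGroup M] [Module ℂ M] {T : C.Form →ₗ[ℂ] M}
    (h : ∀ (b : B) ω, T (C.ι b * ω) = counit (R := ℂ) (b : A) • T ω) :
    augmentationForms C ≤ LinearMap.ker T := by
  refine Submodule.span_le.2 ?_
  rintro x ⟨b, ω, rfl⟩
  rw [SetLike.mem_coe, LinearMap.mem_ker, map_sub, map_smul, h, sub_self]

theorem fibreMk_ι_mul (b : B) (ω : C.Form) : (augmentationForms C).mkQ (C.ι b * ω) =
    counit (R := ℂ) (b : A) • (augmentationForms C).mkQ ω := by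
  rw [← map_smul]
  exact (Submodule.Quotient.eq _).2 (Submodule.subset_span ⟨b, ω, rfl⟩)

/-- By the formula for the right action, ωb = (ω₍₋₂₎ b S(ω₍₋₁₎)) ω₍₀₎ with left coefficient in `B`;
on the fibre this coefficient acts through ε. -/
theorem fibreMk_mul_ι (hmod : IsRelativeHopfModule₀ B C.Form δ.toLinearMap) (ω : C.Form) (b : B) :
    (augmentationForms C).mkQ (ω * C.ι b) =
      counit (R := ℂ) (b : A) • (augmentationForms C).mkQ ω := by
  obtain ⟨t, ht, hω⟩ := hmod.right_smul b ω
  rw [C.op_smul_def] at hω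
  have h1 : ∀ t : B ⊗[ℂ] C.Form, (augmentationForms C).mkQ (leftAction B C.Form t) =
      (augmentationForms C).mkQ (slice counit (LinearMap.rTensor C.Form (incl B) t)) := fun t => by
    induction t with
    | zero => simp
    | add x y hx hy => simp only [map_add, hx, hy]
    | tmul b' f =>
      rw [LinearMap.rTensor_tmul, slice_tmul, map_smul]
      exact fibreMk_ι_mul b' f
  have h2 : ∀ z : A ⊗[ℂ] C.Form, slice counit (LinearMap.rTensor C.Form (adjointMap (b : A)) z) =
      counit (R := ℂ) (b : A) • TensorProduct.lid ℂ C.Form (LinearMap.rTensor C.Form counit z) :=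
    fun z => by
      induction z with
      | zero => simp
      | add x y hx hy => simp only [map_add, smul_add, hx, hy]
      | tmul a f =>
        rw [LinearMap.rTensor_tmul, slice_tmul, counit_adjointMap]
        simp [mul_smul]
  rw [hω, h1, ht, h2, hmod.coaction.counit, map_smul]

/-- Left `B`-generators span the fibre over ℂ, since coefficients in `B` become scalars there. -/
theorem finite_fibre [Module.Finite B C.Form] :
    Module.Finite ℂ (C.Form ⧸ augmentationForms C) := by
  obtain ⟨s, hs⟩ := (Module.Finite.fg_top : (⊤ : Submodule B C.Form).FG)
  classical
  refine ⟨s.image (augmentationForms C).mkQ, ?_⟩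
  rw [eq_top_iff]
  rintro v -
  obtain ⟨ω, rfl⟩ := Submodule.mkQ_surjective _ v
  have hω : ω ∈ Submodule.span B (s : Set C.Form) := hs ▸ Submodule.mem_top
  induction hω using Submodule.span_induction with
  | mem x hx => exact Submodule.subset_span (Finset.mem_coe.2 (Finset.mem_image_of_mem _ hx))
  | zero => simp
  | add x y _ _ hx hy => rw [map_add]; exact Submodule.add_mem _ hx hy
  | smul b x _ hx =>
    rw [C.smul_def, fibreMk_ι_mul]
    exact Submodule.smul_mem _ _ hx

variable (δ) in
/-- The map `ω ↦ S(ω₍₋₁₎) ⊗ ω₍₀₎`. -/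
noncomputable def antipodeTensor : C.Form →ₗ[ℂ] A ⊗[ℂ] C.Form :=
  LinearMap.rTensor C.Form (HopfAlgebra.antipode ℂ) ∘ₗ δ.toLinearMap

/-- Over `B` one has S(b₍₁₎ω₍₋₁₎) ⊗ b₍₂₎ω₍₀₎ = S(ω₍₋₁₎)S(b₍₁₎)b₍₂₎ ⊗ ω₍₀₎, and the antipode axiom
collapses the middle. So the antipode tensor factors through the fibre. -/
theorem balancedMk_antipodeTensor_ι_mul (hC : C.IsCovariant δ) (b : B) (ω : C.Form) :
    (balancedRel B C.Form).mkQ (antipodeTensor δ (C.ι b * ω)) =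
      counit (R := ℂ) (b : A) • (balancedRel B C.Form).mkQ (antipodeTensor δ ω) := by
  obtain ⟨t, ht, hδ⟩ := hC.extends_comul b
  have h1 : ∀ (t : A ⊗[ℂ] B) (z : A ⊗[ℂ] C.Form), (balancedRel B C.Form).mkQ
      (LinearMap.rTensor C.Form (HopfAlgebra.antipode ℂ)
        (LinearMap.lTensor A C.ι.toLinearMap t * z)) =
      (balancedRel B C.Form).mkQ (LinearMap.rTensor C.Form
        (LinearMap.mulRight ℂ (LinearMap.mul' ℂ A (LinearMap.rTensor A (HopfAlgebra.antipode ℂ)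
          (LinearMap.lTensor A (incl B) t))) ∘ₗ HopfAlgebra.antipode ℂ) z) := fun t z => by
    induction z with
    | zero => simp
    | add x y hx hy => simp only [map_add, mul_add, hx, hy]
    | tmul a' f =>
      induction t with
      | zero => simp
      | add x y hx hy =>
        simp only [map_add, add_mul, hx, hy, LinearMap.rTensor_tmul, LinearMap.comp_apply,
          LinearMap.mulRight_apply, mul_add, add_tmul]
      | tmul a b =>
        simp only [LinearMap.lTensor_tmul, LinearMap.rTensor_tmul, LinearMap.comp_apply,
          LinearMap.mulRight_apply, Algebra.TensorProduct.tmul_mul_tmul,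
          HopfAlgebra.antipode_mul_antidistrib, LinearMap.mul'_apply, AlgHom.toLinearMap_apply]
        rw [← mul_assoc]
        exact (balancedMk_mul_tmul _ b f).symm
  have h2 : LinearMap.mul' ℂ A (LinearMap.rTensor A (HopfAlgebra.antipode ℂ)
      (comul (R := ℂ) (b : A))) = algebraMap ℂ A (counit (b : A)) :=
    HopfAlgebra.mul_antipode_rTensor_comul_apply _
  have h3 : LinearMap.mulRight ℂ (algebraMap ℂ A (counit (b : A))) ∘ₗ HopfAlgebra.antipode ℂ =
      counit (R := ℂ) (b : A) • HopfAlgebra.antipode ℂ (A := A) := by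
    ext a
    simp [Algebra.algebraMap_eq_smul_one]
  rw [antipodeTensor, LinearMap.comp_apply, LinearMap.comp_apply, AlgHom.toLinearMap_apply,
    map_mul, hδ, h1, ht, h2, h3, LinearMap.rTensor_smul, LinearMap.smul_apply, map_smul,
    AlgHom.toLinearMap_apply]

theorem balancedMk_antipodeTensor_congr (hC : C.IsCovariant δ) {ω ν : C.Form}
    (h : (augmentationForms C).mkQ ω = (augmentationForms C).mkQ ν) :
    (balancedRel B C.Form).mkQ (antipodeTensor δ ω) =
      (balancedRel B C.Form).mkQ (antipodeTensor δ ν) := by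
  have h1 := augmentationForms_le_ker
    (T := (balancedRel B C.Form).mkQ ∘ₗ antipodeTensor δ)
    (balancedMk_antipodeTensor_ι_mul hC) ((Submodule.Quotient.eq _).1 h)
  rwa [LinearMap.mem_ker, map_sub, sub_eq_zero] at h1

/-- `S(ω₍₋₁₎) ⊗ ω₍₀₎ b = b S(ω₍₋₁₎) ⊗ ω₍₀₎` in `A ⊗_B Ω^•`. -/
theorem balancedMk_antipodeTensor_mul_ι (hmod : IsRelativeHopfModule₀ B C.Form δ.toLinearMap)
    (ω : C.Form) (b : B) :
    (balancedRel B C.Form).mkQ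
        (LinearMap.lTensor A (LinearMap.mulRight ℂ (C.ι b)) (antipodeTensor δ ω)) =
      (balancedRel B C.Form).mkQ
        (LinearMap.rTensor C.Form (LinearMap.mulLeft ℂ (b : A)) (antipodeTensor δ ω)) := by
  have h1 : ∀ (a : A) (t : B ⊗[ℂ] C.Form),
      (balancedRel B C.Form).mkQ (a ⊗ₜ leftAction B C.Form t) =
        (balancedRel B C.Form).mkQ (LinearMap.rTensor C.Form (LinearMap.mulLeft ℂ a)
          (LinearMap.rTensor C.Form (incl B) t)) := fun a t => by
    induction t with
    | zero => simp
    | add x y hx hy => simp only [map_add, tmul_add, hx, hy]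
    | tmul b f => exact (balancedMk_mul_tmul a b f).symm
  have h2 : ∀ z : A ⊗[ℂ] C.Form,
      (balancedRel B C.Form).mkQ (LinearMap.lTensor A (LinearMap.mulRight ℂ (C.ι b)) z) =
        (balancedRel B C.Form).mkQ (contract C.Form
          (LinearMap.mul' ℂ A ∘ₗ LinearMap.lTensor A (adjointMap (b : A)))
          (LinearMap.lTensor A δ.toLinearMap z)) := fun z => by
    induction z with
    | zero => simp
    | add x y hx hy => simp only [map_add, hx, hy]
    | tmul a f =>
      obtain ⟨t, ht, hf⟩ := hmod.right_smul b f
      rw [C.op_smul_def] at hf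
      rw [LinearMap.lTensor_tmul, LinearMap.mulRight_apply, hf, h1, ht, LinearMap.lTensor_tmul]
      congr 1
      induction δ.toLinearMap f with
      | zero => simp
      | add x y hx hy => simp only [map_add, tmul_add, hx, hy]
      | tmul a' f' => simp
  have h3 : (LinearMap.mul' ℂ A ∘ₗ LinearMap.lTensor A (adjointMap (b : A))) ∘ₗ
      LinearMap.rTensor A (HopfAlgebra.antipode ℂ) ∘ₗ comul =
      LinearMap.mulLeft ℂ (b : A) ∘ₗ HopfAlgebra.antipode ℂ := by
    ext a
    rw [LinearMap.comp_apply, LinearMap.comp_apply, LinearMap.comp_apply,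
      ← LinearMap.comp_apply (LinearMap.lTensor A _), LinearMap.lTensor_comp_rTensor,
      antipode_mul_adjointMap]
    rfl
  rw [h2, antipodeTensor, LinearMap.comp_apply, contract_rTensor_antipode,
    hmod.coaction.contract_apply, LinearMap.comp_assoc, h3, LinearMap.rTensor_comp,
    LinearMap.comp_apply]

end Fibre

/-! ### From dual bases of the fibre to dual bases of Ω -/

section DualBases

open TensorProduct Coalgebra

variable {A : Type u} [Ring A] [HopfAlgebra ℂ A] [StarRing A] [StarModule ℂ A]
variable {B : StarSubalgebra ℂ A}
variable {C : DifferentialCalculus B} {δ : C.Form →ₐ[ℂ] A ⊗[ℂ] C.Form} {I : C.Form →ₗ[ℂ] B}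

theorem IsInvariantIntegral.counit_ι_mul (hI : IsInvariantIntegral C δ I) (b : B) (ω : C.Form) :
    counit (R := ℂ) (I (C.ι b * ω) : A) = counit (R := ℂ) (b : A) * counit (R := ℂ) (I ω : A) := by
  rw [hI.ι_mul, ← Bialgebra.counit_mul]
  rfl

/-- The pairing `([x], [w]) ↦ ε(I(x w))` on the fibre `Ω^• / B⁺ Ω^•`. -/
theorem IsInvariantIntegral.exists_fibrePairing (hI : IsInvariantIntegral C δ I)
    (hmod : IsRelativeHopfModule₀ B C.Form δ.toLinearMap) :
    ∃ β : (C.Form ⧸ augmentationForms C) →ₗ[ℂ] Module.Dual ℂ (C.Form ⧸ augmentationForms C),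
      ∀ x w, β ((augmentationForms C).mkQ x) ((augmentationForms C).mkQ w) =
        counit (R := ℂ) (I (x * w) : A) := by
  let e : C.Form →ₗ[ℂ] ℂ := counit ∘ₗ incl B ∘ₗ I
  let P : C.Form →ₗ[ℂ] C.Form →ₗ[ℂ] ℂ := (LinearMap.mul ℂ C.Form).compr₂ e
  have hP : ∀ x w, P x w = counit (R := ℂ) (I (x * w) : A) := fun _ _ => rfl
  let P₁ : (C.Form ⧸ augmentationForms C) →ₗ[ℂ] C.Form →ₗ[ℂ] ℂ :=
    (augmentationForms C).liftQ P <| augmentationForms_le_ker fun b ω => by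
      ext w
      rw [LinearMap.smul_apply, hP, hP, mul_assoc, hI.counit_ι_mul, smul_eq_mul]
  have hP₁ : ∀ x w, P₁ ((augmentationForms C).mkQ x) w = counit (R := ℂ) (I (x * w) : A) :=
    fun _ _ => rfl
  let P₂ : (C.Form ⧸ augmentationForms C) →ₗ[ℂ] (C.Form ⧸ augmentationForms C) →ₗ[ℂ] ℂ :=
    (augmentationForms C).liftQ P₁.flip <| augmentationForms_le_ker fun b w => by
      refine LinearMap.ext fun v => ?_
      obtain ⟨x, rfl⟩ := Submodule.mkQ_surjective _ v
      simp only [LinearMap.smul_apply, LinearMap.flip_apply]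
      rw [hP₁, ← mul_assoc, ← hP₁, fibreMk_mul_ι hmod, map_smul, LinearMap.smul_apply]
  exact ⟨P₂.flip, fun _ _ => rfl⟩

/-- The pairing on the fibre is nondegenerate on the left if the pairing `(x, w) ↦ I(x w)` is. -/
theorem IsInvariantIntegral.fibreMk_eq_zero (hI : IsInvariantIntegral C δ I)
    (hff : IsFaithfullyFlatRight B) (hδ : IsLeftCoaction δ.toLinearMap)
    (hnd : ∀ x, (∀ w, I (x * w) = 0) → x = 0) {m : ℕ} {w : Fin m → C.Form}
    (hw : ∀ ω, ∃ c : Fin m → B, ω = ∑ i, w i * C.ι (c i)) {x : C.Form}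
    (hx : ∀ w, counit (R := ℂ) (I (x * w) : A) = 0) : (augmentationForms C).mkQ x = 0 := by
  -- Because the w_i generate on the right, nondegeneracy makes this left linear map injective, and
  -- flatness keeps it injective after A ⊗_B.
  let f : C.Form →ₗ[B] (Fin m → B) :=
    { toFun := fun x i => I (x * w i)
      map_add' := fun x y => by ext; simp [add_mul]
      map_smul' := fun b x => by
        funext i
        rw [C.smul_def, mul_assoc, hI.ι_mul]
        rfl }
  have hf : Function.Injective f := by
    rw [injective_iff_map_eq_zero]
    refine fun x hx => hnd x fun ω => ?_
    obtain ⟨c, rfl⟩ := hw ω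
    rw [Finset.mul_sum, map_sum]
    refine Finset.sum_eq_zero fun i _ => ?_
    have := congr_fun hx i
    change I (x * w i) = 0 at this
    rw [← mul_assoc, hI.mul_ι, this, zero_mul]
  have h1 : (balancedRel B C.Form).mkQ (antipodeTensor δ x) = 0 := by
    apply hff.balancedMap_injective hf
    rw [map_zero, balancedMap_mk, ← map_zero (balancedRel B (Fin m → B)).mkQ]
    refine balancedMk_pi_ext fun i => ?_
    have h2 : ∀ z : A ⊗[ℂ] C.Form, (balancedRel B B).mkQ (LinearMap.lTensor A (LinearMap.proj i)
        (LinearMap.lTensor A (f.restrictScalars ℂ)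
          (LinearMap.rTensor C.Form (HopfAlgebra.antipode ℂ) z))) =
        (balancedRel B B).mkQ (LinearMap.mul' ℂ A (TensorProduct.map (HopfAlgebra.antipode ℂ)
          (incl B ∘ₗ I ∘ₗ LinearMap.mulRight ℂ (w i)) z) ⊗ₜ 1) := fun z => by
      induction z with
      | zero => simp
      | add x y hx hy => simp only [map_add, add_tmul, hx, hy]
      | tmul a y =>
        have := balancedMk_mul_tmul (HopfAlgebra.antipode ℂ a) (I (y * w i)) (1 : B)
        rw [smul_eq_mul, mul_one] at this
        exact this.symm
    -- The coordinate S(x₍₋₁₎) ∫(x₍₀₎ w_i) equals w_i₍₋₁₎ ε(∫ x w_i₍₀₎), which is zero by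
    -- hypothesis.
    have h3 := hI.antipode_mul hδ x (w i)
    have h4 : (counit ∘ₗ incl B ∘ₗ I ∘ₗ LinearMap.mulLeft ℂ x : C.Form →ₗ[ℂ] ℂ) = 0 :=
      LinearMap.ext hx
    rw [h4, LinearMap.lTensor_zero, LinearMap.zero_apply, map_zero] at h3
    rw [antipodeTensor, LinearMap.comp_apply, h2, AlgHom.toLinearMap_apply, h3, zero_tmul, map_zero,
      map_zero, map_zero]
  -- The map a ⊗ ω ↦ ε(a)[ω] is well defined on A ⊗_B Ω, and as ε ∘ S = ε it recovers [x] from the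
  -- antipode tensor of x.
  have hker : balancedRel B C.Form ≤
      LinearMap.ker ((augmentationForms C).mkQ ∘ₗ slice (counit (R := ℂ) (A := A))) := by
    refine Submodule.span_le.2 ?_
    rintro z ⟨a, b, ω, rfl⟩
    rw [SetLike.mem_coe, LinearMap.mem_ker, map_sub, LinearMap.comp_apply, LinearMap.comp_apply,
      slice_tmul, slice_tmul, C.smul_def, map_smul, map_smul, fibreMk_ι_mul, Bialgebra.counit_mul,
      mul_smul, sub_self]
  have h5 := hker ((Submodule.Quotient.mk_eq_zero _).1 h1)
  have h6 : slice (counit (R := ℂ) (A := A)) (antipodeTensor δ x) = x := by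
    conv_rhs => rw [← hδ.counit x]
    rw [antipodeTensor, LinearMap.comp_apply, slice, LinearMap.comp_apply, LinearEquiv.coe_coe,
      ← LinearMap.comp_apply (LinearMap.rTensor _ _), ← LinearMap.rTensor_comp,
      HopfAlgebra.counit_comp_antipode]
  rwa [LinearMap.mem_ker, LinearMap.comp_apply, h6] at h5

/-- In finite dimension, an injective map from V to its dual is bijective. So each coordinate
functional of a basis [y_j] is represented by some x_j. -/
theorem IsInvariantIntegral.exists_fibre_dual_basis (hI : IsInvariantIntegral C δ I)
    (hff : IsFaithfullyFlatRight B) (hmod : IsRelativeHopfModule₀ B C.Form δ.toLinearMap)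
    (hnd : ∀ x, (∀ w, I (x * w) = 0) → x = 0) {m : ℕ} {w : Fin m → C.Form}
    (hw : ∀ ω, ∃ c : Fin m → B, ω = ∑ i, w i * C.ι (c i)) :
    ∃ (r : ℕ) (x y : Fin r → C.Form), ∀ ω, (augmentationForms C).mkQ ω =
      (augmentationForms C).mkQ (∑ j, counit (R := ℂ) (I (x j * ω) : A) • y j) := by
  have := hmod.finite
  have := finite_fibre (C := C)
  obtain ⟨β, hβ⟩ := hI.exists_fibrePairing hmod
  have hinj : Function.Injective β := by
    rw [injective_iff_map_eq_zero]
    intro v hv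
    obtain ⟨x, rfl⟩ := Submodule.mkQ_surjective _ v
    refine hI.fibreMk_eq_zero hff hmod.coaction hnd hw fun w => ?_
    rw [← hβ, hv, LinearMap.zero_apply]
  have hsurj : Function.Surjective β :=
    (LinearMap.injective_iff_surjective_of_finrank_eq_finrank Subspace.dual_finrank_eq.symm).1 hinj
  let v := Module.finBasis ℂ (C.Form ⧸ augmentationForms C)
  choose y hy using fun j => Submodule.mkQ_surjective (augmentationForms C) (v j)
  choose u hu using fun j => hsurj (v.coord j)
  choose x hx using fun j => Submodule.mkQ_surjective (augmentationForms C) (u j)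
  refine ⟨_, x, y, fun ω => ?_⟩
  rw [map_sum]
  simp only [map_smul, hy, ← hβ, hx, hu]
  exact (v.sum_repr _).symm

/-- Dual bases of `Ω^•` as a right `B`-module, with respect to the pairing `(x, w) ↦ I(x w)`. -/
theorem IsInvariantIntegral.exists_dual_basis (hI : IsInvariantIntegral C δ I)
    (hff : IsFaithfullyFlatRight B) (hC : C.IsCovariant δ)
    (hmod : IsRelativeHopfModule₀ B C.Form δ.toLinearMap)
    (hnd : ∀ x, (∀ w, I (x * w) = 0) → x = 0) {m : ℕ} {w : Fin m → C.Form}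
    (hw : ∀ ω, ∃ c : Fin m → B, ω = ∑ i, w i * C.ι (c i)) :
    ∃ (r : ℕ) (x y : Fin r → C.Form), ∀ ω, ω = ∑ j, y j * C.ι (I (x j * ω)) := by
  obtain ⟨r, x, y, hxy⟩ := hI.exists_fibre_dual_basis hff hmod hnd hw
  let Θ : C.Form →ₗ[ℂ] C.Form →ₗ[ℂ] (Fin m → C.Form) :=
    LinearMap.mk₂ ℂ (fun y x i => y * C.ι (I (x * w i)))
      (fun _ _ _ => by ext; simp [add_mul]) (fun _ _ _ => by ext; simp)
      (fun _ _ _ => by ext; simp [add_mul, mul_add]) (fun _ _ _ => by ext; simp)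
  let Θ' (i : Fin m) : C.Form →ₗ[ℂ] C.Form →ₗ[ℂ] C.Form := Θ.compr₂ (LinearMap.proj i)
  -- The generators are treated as a single tuple, so that one finite family of pairs (y, x) will
  -- serve for all w_i at once.
  let P : Submodule B (Fin m → C.Form) :=
    Submodule.span B (Set.range fun p : C.Form × C.Form => Θ p.1 p.2)
  have hrange : ∀ z z' : A ⊗[ℂ] C.Form, (balancedRel B (Fin m → C.Form)).mkQ
      (TensorProduct.map₂ (LinearMap.mul ℂ A).flip Θ z z') ∈
        LinearMap.range (balancedMap B P.subtype) := fun z z' => by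
    induction z with
    | zero => simp
    | add x y hx hy =>
      simp only [map_add, LinearMap.add_apply]
      exact Submodule.add_mem _ hx hy
    | tmul a y =>
      induction z' with
      | zero => simp
      | add x y hx hy =>
        simp only [map_add]
        exact Submodule.add_mem _ hx hy
      | tmul a' x =>
        refine ⟨(balancedRel B P).mkQ ((a' * a) ⊗ₜ ⟨Θ y x, Submodule.subset_span ⟨(y, x), rfl⟩⟩), ?_⟩
        rfl
  have hproj : ∀ (i : Fin m) (z z' : A ⊗[ℂ] C.Form), LinearMap.lTensor A (LinearMap.proj i)
      (TensorProduct.map₂ (LinearMap.mul ℂ A).flip Θ z z') =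
        TensorProduct.map₂ (LinearMap.mul ℂ A).flip (Θ' i) z z' := fun i z z' => by
    induction z with
    | zero => simp
    | add x y hx hy => simp only [map_add, LinearMap.add_apply, hx, hy]
    | tmul a y =>
      induction z' with
      | zero => simp
      | add x y hx hy => simp only [map_add, hx, hy]
      | tmul a' x => rfl
  -- The right factor ∫(x w_i) on y₍₀₎ can be moved to the left of S(y₍₋₁₎), next to the
  -- `A`-component of z'.
  have hmul : ∀ (i : Fin m) (y : C.Form) (z' : A ⊗[ℂ] C.Form), (balancedRel B C.Form).mkQ
      (TensorProduct.map₂ (LinearMap.mul ℂ A).flip (Θ' i) (antipodeTensor δ y) z') =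
      (balancedRel B C.Form).mkQ (LinearMap.rTensor C.Form (LinearMap.mulLeft ℂ
        (LinearMap.mul' ℂ A (LinearMap.lTensor A (incl B ∘ₗ I ∘ₗ LinearMap.mulRight ℂ (w i)) z')))
          (antipodeTensor δ y)) := fun i y z' => by
    induction z' with
    | zero => simp
    | add x y hx hy =>
      have hadd : ∀ a b : A, LinearMap.mulLeft ℂ (a + b) =
        LinearMap.mulLeft ℂ a + LinearMap.mulLeft ℂ b := map_add (LinearMap.mul ℂ A)
      simp only [map_add, hx, hy, hadd, LinearMap.rTensor_add, LinearMap.add_apply]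
    | tmul a' x =>
      have h1 : ∀ z : A ⊗[ℂ] C.Form,
          TensorProduct.map₂ (LinearMap.mul ℂ A).flip (Θ' i) z (a' ⊗ₜ x) =
          LinearMap.rTensor C.Form (LinearMap.mulLeft ℂ a')
            (LinearMap.lTensor A (LinearMap.mulRight ℂ (C.ι (I (x * w i)))) z) := fun z => by
        induction z with
        | zero => simp
        | add x y hx hy => simp only [map_add, LinearMap.add_apply, hx, hy]
        | tmul a y => rfl
      rw [h1, ← balancedMulLeft_mk, balancedMk_antipodeTensor_mul_ι hmod, balancedMulLeft_mk,
        ← LinearMap.comp_apply (LinearMap.rTensor _ _), ← LinearMap.rTensor_comp,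
        ← LinearMap.mulLeft_mul]
      rfl
  -- The antipode tensor sees only the class in the fibre, where ∑ ε(∫ x_j ω) y_j represents ω.
  have hsum : ∀ z : A ⊗[ℂ] C.Form,
      ∑ j, (balancedRel B C.Form).mkQ (LinearMap.rTensor C.Form (LinearMap.mulLeft ℂ
        (TensorProduct.rid ℂ A (LinearMap.lTensor A
          (counit ∘ₗ incl B ∘ₗ I ∘ₗ LinearMap.mulLeft ℂ (x j)) z))) (antipodeTensor δ (y j))) =
      (balancedRel B C.Form).mkQ (contract C.Form (LinearMap.mul' ℂ A)
        (LinearMap.lTensor A (antipodeTensor δ) z)) := fun z => by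
    induction z with
    | zero => simp
    | add x y hx hy =>
      have hadd : ∀ a b : A, LinearMap.mulLeft ℂ (a + b) =
        LinearMap.mulLeft ℂ a + LinearMap.mulLeft ℂ b := map_add (LinearMap.mul ℂ A)
      simp only [map_add, ← hx, ← hy, hadd, LinearMap.rTensor_add, LinearMap.add_apply,
        Finset.sum_add_distrib]
    | tmul a ω =>
      have h1 : ∀ z : A ⊗[ℂ] C.Form, contract C.Form (LinearMap.mul' ℂ A) (a ⊗ₜ z) =
          LinearMap.rTensor C.Form (LinearMap.mulLeft ℂ a) z := fun z => by
        induction z with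
        | zero => simp
        | add x y hx hy => simp only [map_add, tmul_add, hx, hy]
        | tmul a y => simp
      rw [LinearMap.lTensor_tmul, h1, ← balancedMulLeft_mk,
        balancedMk_antipodeTensor_congr hC (hxy ω), map_sum, map_sum, map_sum]
      refine Finset.sum_congr rfl fun j _ => ?_
      rw [map_smul, map_smul, map_smul, balancedMulLeft_mk, LinearMap.lTensor_tmul,
        TensorProduct.rid_tmul]
      have hsm : ∀ c : ℂ, LinearMap.mulLeft ℂ (c • a) = c • LinearMap.mulLeft ℂ a :=
        fun c => map_smul (LinearMap.mul ℂ A) c a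
      rw [hsm, LinearMap.rTensor_smul, LinearMap.smul_apply, map_smul]
      rfl
  have hmem : w ∈ P := by
    refine hff.mem_of_balancedMk ?_
    have : (balancedRel B (Fin m → C.Form)).mkQ (1 ⊗ₜ w) =
        (balancedRel B (Fin m → C.Form)).mkQ (∑ j, TensorProduct.map₂ (LinearMap.mul ℂ A).flip Θ
          (antipodeTensor δ (y j)) (antipodeTensor δ (x j))) := by
      refine balancedMk_pi_ext fun i => ?_
      rw [map_sum, map_sum]
      simp only [hproj, hmul]
      have h1 : ∀ j, LinearMap.mul' ℂ A (LinearMap.lTensor A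
          (incl B ∘ₗ I ∘ₗ LinearMap.mulRight ℂ (w i)) (antipodeTensor δ (x j))) =
          TensorProduct.rid ℂ A (LinearMap.lTensor A
            (counit ∘ₗ incl B ∘ₗ I ∘ₗ LinearMap.mulLeft ℂ (x j)) (δ (w i))) := fun j => by
        rw [← hI.antipode_mul hmod.coaction, antipodeTensor, LinearMap.comp_apply,
          ← LinearMap.comp_apply (LinearMap.lTensor _ _), LinearMap.lTensor_comp_rTensor]
        rfl
      simp only [h1]
      rw [hsum]
      -- The sum has become w_i₍₋₂₎ S(w_i₍₋₁₎) ⊗ w_i₍₀₎, which is 1 ⊗ w_i.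
      have := hmod.coaction.mul_antipode_cancel (w i)
      rw [← antipodeTensor, AlgHom.toLinearMap_apply] at this
      rw [this]
      rfl
    rw [this, map_sum]
    exact Submodule.sum_mem _ fun j _ => hrange _ _
  obtain ⟨c, hc⟩ := Finsupp.mem_span_range_iff_exists_finsupp.1 hmem
  -- The new basis is indexed by the pairs (y, x) used to write w in P, with the left coefficients
  -- absorbed into y.
  refine ⟨c.support.card, fun j => (c.support.equivFin.symm j : C.Form × C.Form).2,
    fun j => c (c.support.equivFin.symm j) • (c.support.equivFin.symm j : C.Form × C.Form).1,
    fun ω => ?_⟩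
  have hc' : ∀ i, w i = ∑ j : Fin c.support.card,
      (c (c.support.equivFin.symm j) • (c.support.equivFin.symm j : C.Form × C.Form).1) *
        C.ι (I ((c.support.equivFin.symm j : C.Form × C.Form).2 * w i)) := fun i => by
    rw [Equiv.sum_comp c.support.equivFin.symm (fun p : c.support =>
      (c p • (p : C.Form × C.Form).1) * C.ι (I ((p : C.Form × C.Form).2 * w i))),
      Finset.sum_coe_sort c.support (fun p => (c p • p.1) * C.ι (I (p.2 * w i)))]
    conv_lhs => rw [← hc]
    rw [Finsupp.sum, Finset.sum_apply]
    refine Finset.sum_congr rfl fun p _ => ?_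
    rw [Pi.smul_apply, C.smul_def, C.smul_def, mul_assoc]
    rfl
  obtain ⟨d, rfl⟩ := hw ω
  conv_lhs => enter [2, i]; rw [hc' i, Finset.sum_mul]
  rw [Finset.sum_comm]
  refine Finset.sum_congr rfl fun j _ => ?_
  rw [Finset.mul_sum, map_sum, map_sum, Finset.mul_sum]
  refine Finset.sum_congr rfl fun i _ => ?_
  rw [← mul_assoc _ (w i), hI.mul_ι, map_mul C.ι, mul_assoc]

end DualBases

/-! ### The metric as an isomorphism onto the dual module -/

section Main

open TensorProduct

variable {A : Type u} [Ring A] [HopfAlgebra ℂ A] [StarRing A] [StarModule ℂ A]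
variable {B : StarSubalgebra ℂ A}

namespace HermitianStructure

variable {B : Type u} [Ring B] [StarRing B] [Algebra ℂ B] {C : StarCalculus B} {n : ℕ}
  (H : HermitianStructure C n)

theorem IsPositiveDefinite.eq_zero {H : HermitianStructure C n} (hpos : H.IsPositiveDefinite)
    {ω : C.Form} (h : H.metric ω ω = 0) : ω = 0 := by
  by_contra hne
  exact (hpos ω hne).2 h

/-- The map `ω̄ ↦ g_σ(-, ω)`. -/
noncomputable def metricDual : ConjModule C.Form →ₗ[Bᵐᵒᵖ] (C.Form →ₗ[B] B) where
  toFun ω :=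
    { toFun := fun ν => H.metric ν ω
      map_add' := fun ν ν' => H.metric_add_left ν ν' ω
      map_smul' := fun b ν => H.metric_smul_left b ν ω }
  map_add' ω ω' := LinearMap.ext fun ν => H.metric_add_right ν ω ω'
  map_smul' b ω := LinearMap.ext fun ν => by
    have h := H.metric_smul_right (star b.unop) ν ω
    rw [star_star] at h
    exact h

theorem metricDual_apply (ω ν : C.Form) :
    H.metricDual (ConjModule.mk ω) ν = H.metric ν ω := rfl

theorem metricDual_injective {H : HermitianStructure C n} (hpos : H.IsPositiveDefinite) :
    Function.Injective H.metricDual := by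
  rw [injective_iff_map_eq_zero]
  exact fun ω hω => hpos.eq_zero (LinearMap.congr_fun hω ω)

variable {H} in
/-- Dual bases with respect to the metric make `ω̄ ↦ g_σ(-, ω)` surjective. -/
theorem metricDual_surjective {r : ℕ} {u z : Fin r → C.Form}
    (huz : ∀ ω, ω = ∑ j, H.metric ω (u j) • z j) : Function.Surjective H.metricDual := by
  intro φ
  -- The metric is conjugate-linear in its second argument, so starred coefficients give ν ↦ ∑ g(ν,
  -- u_j) φ(z_j) = φ(ν).
  refine ⟨ConjModule.mk (∑ j, star (φ (z j)) • u j), LinearMap.ext fun ν => ?_⟩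
  have h : H.metricDual (ConjModule.mk (∑ j, star (φ (z j)) • u j)) ν =
      ∑ j, H.metric ν (u j) * φ (z j) := by
    rw [metricDual_apply]
    have := map_sum (AddMonoidHom.mk' (H.metric ν) (H.metric_add_right ν))
      (fun j => star (φ (z j)) • u j) Finset.univ
    refine this.trans (Finset.sum_congr rfl fun j _ => ?_)
    exact (H.metric_smul_right _ _ _).trans (by rw [star_star])
  rw [h]
  conv_rhs => rw [huz ν, map_sum]
  simp only [map_smul, smul_eq_mul]

variable {H} in
-- The expansion exhibits Ω as a direct summand of B^r: taking the coefficients is a section of the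
-- linear combination map.
theorem projective_of_dual_basis {r : ℕ} {u z : Fin r → C.Form}
    (huz : ∀ ω, ω = ∑ j, H.metric ω (u j) • z j) : Module.Projective B C.Form := by
  refine Module.Projective.of_split (M := Fin r → B)
    (LinearMap.pi fun j => H.metricDual (ConjModule.mk (u j)))
    (Fintype.linearCombination B z) (LinearMap.ext fun ω => ?_)
  rw [LinearMap.comp_apply, Fintype.linearCombination_apply]
  exact (huz ω).symm

end HermitianStructure

variable {C : StarCalculus B} {δ : C.Form →ₐ[ℂ] A ⊗[ℂ] C.Form} {n : ℕ}

/-- The involution exchanges the left and right actions, so conjugates of left generators generate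
on the right. -/
theorem StarCalculus.exists_right_generators (C : StarCalculus B) [Module.Finite B C.Form] :
    ∃ (m : ℕ) (w : Fin m → C.Form), ∀ ω, ∃ c : Fin m → B, ω = ∑ i, w i * C.ι (c i) := by
  obtain ⟨m, f, hf⟩ := Module.Finite.exists_fin (R := B) (M := C.Form)
  refine ⟨m, fun i => C.conj (f i), fun ω => ?_⟩
  have hω : C.conj ω ∈ Submodule.span B (Set.range f) := hf ▸ Submodule.mem_top
  obtain ⟨c, hc⟩ := (Submodule.mem_span_range_iff_exists_fun B).1 hω
  refine ⟨fun i => star (c i), ?_⟩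
  rw [← C.conj_conj ω, ← hc, map_sum]
  exact Finset.sum_congr rfl fun i _ => C.conj_ι_mul _ _

/-- Dual bases of the left `B`-module `Ω^•` with respect to the metric. -/
theorem HermitianStructure.IsCovariant.exists_dual_basis {H : HermitianStructure C n}
    (hcov : H.IsCovariant δ) (hpos : H.IsPositiveDefinite) (hff : IsFaithfullyFlatRight B)
    (hC : C.IsCovariant δ) (hmod : IsRelativeHopfModule₀ B C.Form δ.toLinearMap) :
    ∃ (r : ℕ) (u z : Fin r → C.Form), ∀ ω, ω = ∑ j, H.metric ω (u j) • z j := by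
  have := hmod.finite
  obtain ⟨m, w, hw⟩ := C.exists_right_generators
  obtain ⟨r, x, y, hxy⟩ := (hcov.isInvariantIntegral hC).exists_dual_basis hff hC hmod
    -- Nondegeneracy is tested at w = ∗(x*), where ∫ x w is g(x, x).
    (fun x hx => hpos.eq_zero (hx _)) hw
  choose u hu using fun j => H.exists_star_integral_eq_metric (x j)
  refine ⟨r, u, fun j => C.conj (y j), fun ω => ?_⟩
  -- Conjugation turns the right expansion of ω* into a left expansion of ω with coefficients (∫ x_j
  -- ω*)*, which are of the form g(ω, u_j).
  have h := congr_arg C.conj (hxy (C.conj ω))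
  rw [C.conj_conj, map_sum] at h
  refine h.trans (Finset.sum_congr rfl fun j _ => ?_)
  rw [C.conj_mul_ι, hu, C.smul_def]

end Main

end NCGeom

theorem mainTheorem11
    {A : Type u} [Ring A] [HopfAlgebra ℂ A] [StarRing A] [StarModule ℂ A]
    (hA : NCGeom.IsHopfStarAlgebra A)
    (B : StarSubalgebra ℂ A) (hB : NCGeom.IsQuantumHomogeneous B)
    (C : NCGeom.StarCalculus B) (δ : C.Form →ₐ[ℂ] A ⊗[ℂ] C.Form)
    (hC : C.IsCovariant δ)
    (hmod : NCGeom.IsRelativeHopfModule₀ B C.Form δ.toLinearMap)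
    (n : ℕ) (H : NCGeom.HermitianStructure C n)
    (hcov : H.IsCovariant δ) (hpos : H.IsPositiveDefinite) :
    ∃ h : NCGeom.ConjModule C.Form ≃ₗ[Bᵐᵒᵖ] (C.Form →ₗ[B] B),
      NCGeom.IsHermitianModule h ∧
      (∀ ω ν : C.Form, h (NCGeom.ConjModule.mk ω) ν = H.metric ν ω) ∧
      (∀ (k : ℕ), ∀ ω ∈ C.deg k, ∀ ν ∈ C.deg k,
        C.ι (h (NCGeom.ConjModule.mk ω) ν) = H.hodge (ν * H.hodge (C.conj ω))) := by
  obtain ⟨r, u, z, huz⟩ := hcov.exists_dual_basis hpos hB.faithfullyFlat hC hmod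
  refine ⟨LinearEquiv.ofBijective H.metricDual
    ⟨NCGeom.HermitianStructure.metricDual_injective hpos,
      NCGeom.HermitianStructure.metricDual_surjective huz⟩,
    ⟨hmod.finite, NCGeom.HermitianStructure.projective_of_dual_basis huz,
      fun ω ν => H.metric_conj_symm ω ν, hpos⟩,
    fun ω ν => rfl, fun k ω hω ν hν => H.ι_metric hν hω⟩
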